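/- Let $\Gamma$ be a bipartite distance-regular graph (finite, undirected, simple, connected) with vertex set $X$, path-length distance $\partial$, diameter $D\ge 4$, valency $k\ge 3$, and intersection numbers $p^h_{ij}=|\{z:\partial(x,z)=i,\ \partial(z,y)=j\}|$ (where $\partial(x,y)=h$), $c_i=p^i_{1,i-1}$, $c_0=0$, $b_i=p^i_{1,i+1}$, $b_D=0$, $k_i=p^0_{ii}$. Let $A_i\in \mathrm{Mat}_X(\mathbb C)$ be the $i$-th distance matrix, $A=A_1$ the adjacency matrix, $\theta_0>\theta_1>\cdots>\theta_D$ the distinct eigenvalues of $A$, and $E_j$ the primitive idempotent for $\theta_j$, i.e. the orthogonal projection of $V=\mathbb C^X$ onto the $\theta_j$-eigenspace of $A$. Fix $x\in X$. Let $E^*_i$ be the diagonal matrix whose $(y,y)$ entry is $1$ if $\partial(x,y)=i$ and $0$ otherwise, and let $T$ be the subalgebra of $\mathrm{Mat}_X(\mathbb C)$ generated by $A,E_0^*,\dots,E_D^*$. A $T$-module is a $T$-invariant subspace $W\subseteq V$; an irreducible $T$-module $W$ is thin if $\dim E_i^*W\le 1$ for $0\le i\le D$, and its endpoint is $\min\{i: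 0\le i\le D,\ E_i^*W\ne 0\}$. If $W$ is thin and irreducible with endpoint $2$, its local eigenvalue is the eigenvalue of $E_2^*A_2E_2^*$ on the one-dimensional space $E_2^*W$. Define polynomials $f_i\in\mathbb R[\lambda]$ by $f_{-1}=0$, $f_0=1$ and $\lambda f_i=b_{i-1}f_{i-1}+c_{i+1}f_{i+1}$ $(0\le i\le D-1)$, and put $p_i=f_i+f_{i-2}+f_{i-4}+\cdots$ (ending with $f_0$ or $f_1$) for $0\le i\le D$. Let $n\in\{1,\lfloor D/2\rfloor\}$ if $D$ is odd, and $n=1$ if $D$ is even. Put $\theta=\theta_n$ and $$\tilde\theta_n=-1-\frac{b_2b_3}{\theta_n^2-b_2},\qquad g_i=\sum_{\substack{0\le h\le i\\ i-h\ \mathrm{even}}}\frac{p_h(\theta)\,k_ib_ib_{i+1}}{p_i(\theta)\,k_hb_hb_{h+1}}\,p_h\qquad(0\le i\le D-2).$$ Let $W$ be a thin irreducible $T$-module with endpoint $2$ and local eigenvalue $\tilde\theta_n$, and let $v$ be a nonzero vector in $E_2^*W$. Then the vectors $E_jv$ $(1\le j\le D-1,\ j\ne n,\ j\ne D-n)$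 form a basis of $W$, the vectors $E^*_{i+2}A_iv$ $(0\le i\le D-4)$ form a basis of $W$, and the two bases are related by $$E^*_{i+2}A_iv=\sum_{\substack{1\le j\le D-1\\ j\ne n,\ j\ne D-n}}g_i(\theta_j)\,E_jv\qquad(0\le i\le D-4).$$ -/

import Mathlib

open Polynomial

namespace DRG

section Graph

variable {X : Type*} [Fintype X]

/-- `Γ` is distance-regular: it is connected, and the number of vertices `z` with
`∂(x,z) = i` and `∂(z,y) = j` depends only on `i`, `j` and `∂(x,y)`. -/
def IsDistanceRegular (Γ : SimpleGraph X) : Prop :=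
  Γ.Connected ∧ ∀ i j : ℕ, ∀ x y x' y' : X, Γ.dist x y = Γ.dist x' y' →
    (Finset.univ.filter fun z => Γ.dist x z = i ∧ Γ.dist z y = j).card =
      (Finset.univ.filter fun z => Γ.dist x' z = i ∧ Γ.dist z y' = j).card

/-- The intersection number `p^h_{ij}`: the number of `z` with `∂(x,z) = i` and `∂(z,y) = j`, where
`x, y` are at distance `h`. In a distance-regular graph all these pairs give the same
number; it is extracted here as a maximum over the pairs (which is `0` when there is no such pair). -/
noncomputable def intersectionNumber (Γ : SimpleGraph X) (h i j : ℕ) : ℕ :=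
  (Finset.univ.filter fun q : X × X => Γ.dist q.1 q.2 = h).sup fun q =>
    (Finset.univ.filter fun z => Γ.dist q.1 z = i ∧ Γ.dist z q.2 = j).card

/-- `c_i = p^i_{1,i-1}` for `i ≥ 1`, and `c_0 = 0`. -/
noncomputable def c (Γ : SimpleGraph X) : ℕ → ℝ
  | 0 => 0
  | i + 1 => intersectionNumber Γ (i + 1) 1 i

/-- `b_i = p^i_{1,i+1}`. (For `i` at least the diameter this is `0`.) -/
noncomputable def b (Γ : SimpleGraph X) (i : ℕ) : ℝ :=
  intersectionNumber Γ i 1 (i + 1)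

/-- The `i`-th valency `k_i = p^0_{ii}`. -/
noncomputable def kk (Γ : SimpleGraph X) (i : ℕ) : ℝ :=
  intersectionNumber Γ 0 i i

/-- The polynomials `f_i`: `f_0 = 1` and `λ f_i = b_{i-1} f_{i-1} + c_{i+1} f_{i+1}`, `f_{-1} = 0`. -/
noncomputable def f (Γ : SimpleGraph X) : ℕ → ℝ[X]
  | 0 => 1
  | 1 => C (c Γ 1)⁻¹ * Polynomial.X
  | i + 2 => C (c Γ (i + 2))⁻¹ * (Polynomial.X * f Γ (i + 1) - C (b Γ i) * f Γ i)

/-- `p_i = f_i + f_{i-2} + f_{i-4} + ⋯`, ending with `f_0` or `f_1`. -/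
noncomputable def p (Γ : SimpleGraph X) (i : ℕ) : ℝ[X] :=
  ∑ h ∈ (Finset.range (i + 1)).filter (fun h => Even (i - h)), f Γ h

/-- The polynomials `g_i` associated with the real number `θ`. -/
noncomputable def g (Γ : SimpleGraph X) (θ : ℝ) (i : ℕ) : ℝ[X] :=
  ∑ h ∈ (Finset.range (i + 1)).filter (fun h => Even (i - h)),
    C (((p Γ h).eval θ * kk Γ i * b Γ i * b Γ (i + 1)) /
       ((p Γ i).eval θ * kk Γ h * b Γ h * b Γ (h + 1))) * p Γ h

/-- `z̃ = -1 - b_2 b_3 / (z² - b_2)`, for a real number `z` with `z² ≠ b_2`. -/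
noncomputable def tilde (Γ : SimpleGraph X) (z : ℝ) : ℝ :=
  -1 - b Γ 2 * b Γ 3 / (z ^ 2 - b Γ 2)

end Graph

section Matrices

variable {X : Type*} [Fintype X] [DecidableEq X]

/-- The `i`-th distance matrix `A_i`. The adjacency matrix is `A_1`. -/
noncomputable def distMatrix (Γ : SimpleGraph X) (i : ℕ) : Matrix X X ℂ :=
  Matrix.of fun x y => if Γ.dist x y = i then 1 else 0

/-- The adjacency matrix acting on the Hermitian space `ℂ^X`. -/
noncomputable def adjOp (Γ : SimpleGraph X) :
    EuclideanSpace ℂ X →ₗ[ℂ] EuclideanSpace ℂ X :=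
  Matrix.toEuclideanLin (distMatrix Γ 1)

theorem finite_eigenvalues (Γ : SimpleGraph X) :
    {t : ℝ | Module.End.HasEigenvalue (adjOp Γ) (t : ℂ)}.Finite :=
  (Module.End.finite_hasEigenvalue (adjOp Γ)).preimage Complex.ofReal_injective.injOn

/-- `θ_i`: the entry number `i` (counted from `0`) in the list of the distinct eigenvalues of the
adjacency matrix, sorted in decreasing order. (The adjacency matrix is real symmetric, so all
its eigenvalues are real.) -/
noncomputable def eigenvalue (Γ : SimpleGraph X) (i : ℕ) : ℝ :=
  ((finite_eigenvalues Γ).toFinset.sort (fun s t => t ≤ s)).getD i 0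

/-- The primitive idempotent `E_i`: the matrix of the orthogonal projection of `ℂ^X` onto the
eigenspace of the adjacency matrix for `θ_i`. -/
noncomputable def primIdem (Γ : SimpleGraph X) (i : ℕ) : Matrix X X ℂ :=
  Matrix.toEuclideanLin.symm
    ((Module.End.eigenspace (adjOp Γ) (eigenvalue Γ i : ℂ)).starProjection :
      EuclideanSpace ℂ X →ₗ[ℂ] EuclideanSpace ℂ X)

/-- The dual idempotent `E*_i = E*_i(x)`. -/
noncomputable def dualIdem (Γ : SimpleGraph X) (x : X) (i : ℕ) : Matrix X X ℂ :=
  Matrix.diagonal fun y => if Γ.dist x y = i then 1 else 0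

/-- The Bose-Mesner algebra `M`. -/
def boseMesner (Γ : SimpleGraph X) : Subalgebra ℂ (Matrix X X ℂ) :=
  Algebra.adjoin ℂ {distMatrix Γ 1}

/-- The dual Bose-Mesner algebra `M* = M*(x)`. -/
def dualBoseMesner (Γ : SimpleGraph X) (x : X) : Subalgebra ℂ (Matrix X X ℂ) :=
  Algebra.adjoin ℂ (Set.range (dualIdem Γ x))

/-- The subconstituent algebra `T = T(x)`, generated by `M` and `M*`. -/
def subconstituentAlgebra (Γ : SimpleGraph X) (x : X) : Subalgebra ℂ (Matrix X X ℂ) :=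
  boseMesner Γ ⊔ dualBoseMesner Γ x

/-- A `T`-module: a subspace `W` of `ℂ^X` with `B W ⊆ W` for all `B ∈ T`. -/
def IsTModule (Γ : SimpleGraph X) (x : X) (W : Submodule ℂ (X → ℂ)) : Prop :=
  ∀ B ∈ subconstituentAlgebra Γ x, ∀ w ∈ W, B.mulVec w ∈ W

def IsIrreducibleTModule (Γ : SimpleGraph X) (x : X) (W : Submodule ℂ (X → ℂ)) : Prop :=
  IsTModule Γ x W ∧ W ≠ ⊥ ∧ ∀ W' : Submodule ℂ (X → ℂ), IsTModule Γ x W' → W' ≤ W →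
    W' = ⊥ ∨ W' = W

/-- The subspace `E*_i W`. -/
noncomputable def dualPart (Γ : SimpleGraph X) (x : X) (i : ℕ) (W : Submodule ℂ (X → ℂ)) :
    Submodule ℂ (X → ℂ) :=
  W.map (dualIdem Γ x i).mulVecLin

/-- `W` is thin: `dim E*_i W ≤ 1` for `0 ≤ i ≤ D`. -/
def IsThin (Γ : SimpleGraph X) (x : X) (W : Submodule ℂ (X → ℂ)) : Prop :=
  ∀ i ≤ Γ.diam, Module.finrank ℂ (dualPart Γ x i W) ≤ 1

/-- The endpoint `min {i | 0 ≤ i ≤ D, E*_i W ≠ 0}` of `W`. -/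
noncomputable def endpoint (Γ : SimpleGraph X) (x : X) (W : Submodule ℂ (X → ℂ)) : ℕ :=
  sInf {i | i ≤ Γ.diam ∧ dualPart Γ x i W ≠ ⊥}

/-- `η` is the local eigenvalue of `W` (a thin irreducible `T`-module with endpoint `2`): the
nonzero space `E*_2 W` consists of eigenvectors of `E*_2 A_2 E*_2` with eigenvalue `η`. -/
def HasLocalEigenvalue (Γ : SimpleGraph X) (x : X) (W : Submodule ℂ (X → ℂ)) (η : ℝ) : Prop :=
  dualPart Γ x 2 W ≠ ⊥ ∧ ∀ w ∈ dualPart Γ x 2 W,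
    (dualIdem Γ x 2 * distMatrix Γ 2 * dualIdem Γ x 2).mulVec w = (η : ℂ) • w

/-- The index set `{j | 1 ≤ j ≤ D - 1, j ≠ n, j ≠ D - n}`. -/
def indexSet (D n : ℕ) : Finset ℕ :=
  (Finset.Icc 1 (D - 1)).filter fun j => j ≠ n ∧ j ≠ D - n

end Matrices

end DRG

/-!
For `v ∈ E*_2 W` the only nonzero parts of `A_i v` lie at distance `i - 2`, `i` and `i + 2` from `x`
and these determine each other, so `p_i(A) v = E*_{i+2} A_i v - E*_i A_{i+2} v`. The entries of
`E_j` satisfy the three-term recurrence of `Γ`, and computing `‖E_j v‖²` from it shows that `E_j v`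
vanishes exactly for `θ_j = ±θ_0, ±θ_n`. As `W` is generated by `v` under `A` alone, the remaining
`E_j v` form a basis of `W`, so `dim W = D - 3` and `E*_{i+2} A_i v ≠ 0` exactly for `i ≤ D - 4`.
Thinness makes `E*_{i+2} A_{i+4} v` a multiple of `E*_{i+2} A_i v`; the action of `A` gives a
recurrence for the ratios, which starts from the local eigenvalue and is solved by the quotients of
the coefficients of the `g_i`. Hence `g_i(A) v = E*_{i+2} A_i v`, and decomposing `v = ∑ E_j v`
gives the transition matrix.
-/

namespace DRG

open Finset Matrix

section Graph

variable {X : Type*} {Γ : SimpleGraph X}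

theorem exists_adj_dist (hc : Γ.Connected) {u z : X} {i : ℕ} (h : Γ.dist u z = i + 1) :
    ∃ w, Γ.dist u w = 1 ∧ Γ.dist w z = i := by
  obtain ⟨p, hp⟩ := hc.exists_walk_length_eq_dist u z
  cases p with
  | nil => simp at h
  | @cons _ w _ huw q =>
    have hdist_uw := SimpleGraph.dist_eq_one_iff_adj.2 huw
    have hle := SimpleGraph.dist_le q
    have htri := hc.dist_triangle (u := u) (v := w) (w := z)
    rw [SimpleGraph.Walk.length_cons] at hp
    exact ⟨w, hdist_uw, by omega⟩

theorem even_dist_add_dist_add_dist (hc : Γ.Connected) (hb : Γ.IsBipartite) (u w z : X) :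
    Even (Γ.dist u w + Γ.dist w z + Γ.dist z u) := by
  obtain ⟨p, hp⟩ := hc.exists_walk_length_eq_dist u w
  obtain ⟨q, hq⟩ := hc.exists_walk_length_eq_dist w z
  obtain ⟨r, hr⟩ := hc.exists_walk_length_eq_dist z u
  have := SimpleGraph.two_colorable_iff_forall_loop_even.1 hb u ((p.append q).append r)
  rwa [SimpleGraph.Walk.length_append, SimpleGraph.Walk.length_append, hp, hq, hr] at this

theorem dist_eq_or_eq_of_dist_eq_one (hc : Γ.Connected) (hb : Γ.IsBipartite) {u w : X} (z : X)
    (h : Γ.dist u w = 1) :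
    Γ.dist w z = Γ.dist u z + 1 ∨ Γ.dist w z + 1 = Γ.dist u z := by
  have h1 := hc.dist_triangle (u := u) (v := w) (w := z)
  have h2 := hc.dist_triangle (u := w) (v := u) (w := z)
  have h3 := even_dist_add_dist_add_dist hc hb u w z
  rw [SimpleGraph.dist_comm (u := w) (v := u)] at h2
  rw [SimpleGraph.dist_comm (u := z) (v := u)] at h3
  rcases h3 with ⟨r, hr⟩
  omega

theorem dist_le_diam_of_connected [Finite X] (hc : Γ.Connected) (x y : X) :
    Γ.dist x y ≤ Γ.diam := by
  have : Nonempty X := ⟨x⟩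
  exact SimpleGraph.dist_le_diam (SimpleGraph.connected_iff_ediam_ne_top.1 hc)

theorem exists_dist_eq (hc : Γ.Connected) {i : ℕ} (hi : i ≤ Γ.diam) :
    ∃ u z : X, Γ.dist u z = i := by
  have : Nonempty X := hc.nonempty
  obtain ⟨u₀, z, h₀⟩ := Γ.exists_dist_eq_diam
  induction hi using Nat.decreasingInduction with
  | self => exact ⟨u₀, z, h₀⟩
  | of_succ i _ ih =>
    obtain ⟨u, z, huz⟩ := ih
    obtain ⟨w, -, hw⟩ := exists_adj_dist hc huz
    exact ⟨w, z, hw⟩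

end Graph

theorem c_zero {X : Type*} [Fintype X] (Γ : SimpleGraph X) : c Γ 0 = 0 := rfl

namespace IsDistanceRegular

variable {X : Type*} [Fintype X] {Γ : SimpleGraph X} (hΓ : IsDistanceRegular Γ)

include hΓ

theorem card_filter_eq_intersectionNumber (i j : ℕ) (x y : X) :
    #{z | Γ.dist x z = i ∧ Γ.dist z y = j} = intersectionNumber Γ (Γ.dist x y) i j := by
  refine le_antisymm
    (le_sup (f := fun q : X × X => #{z | Γ.dist q.1 z = i ∧ Γ.dist z q.2 = j})
      (b := (x, y)) (by simp))
    (Finset.sup_le ?_)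
  rintro ⟨u, w⟩ h
  exact (hΓ.2 i j u w x y (mem_filter.1 h).2).le

theorem card_filter_dist_eq (i : ℕ) (y : X) : (#{z | Γ.dist z y = i} : ℝ) = kk Γ i := by
  have h := hΓ.card_filter_eq_intersectionNumber i i y y
  rw [SimpleGraph.dist_self] at h
  rw [kk, ← h]
  congr! 4 with z
  rw [SimpleGraph.dist_comm (u := y), and_self]

theorem kk_pos {i : ℕ} (hi : i ≤ Γ.diam) : 0 < kk Γ i := by
  obtain ⟨y, z, h⟩ := exists_dist_eq hΓ.1 hi
  rw [← hΓ.card_filter_dist_eq i z]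
  exact_mod_cast card_pos.2 ⟨y, by simpa using h⟩

theorem kk_zero : kk Γ 0 = 1 := by
  obtain ⟨y⟩ := hΓ.1.nonempty
  rw [← hΓ.card_filter_dist_eq 0 y]
  norm_cast
  refine card_eq_one.2 ⟨y, ?_⟩
  ext z
  simp only [hΓ.1.dist_eq_zero_iff, mem_filter, mem_univ, true_and, mem_singleton]

theorem c_pos {i : ℕ} (h0 : 1 ≤ i) (hi : i ≤ Γ.diam) : 0 < c Γ i := by
  obtain ⟨y, z, h⟩ := exists_dist_eq hΓ.1 hi
  obtain ⟨m, rfl⟩ := Nat.exists_eq_add_of_le' h0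
  obtain ⟨w, hyw, hwz⟩ := exists_adj_dist hΓ.1 h
  rw [c, ← h, ← hΓ.card_filter_eq_intersectionNumber 1 m y z]
  exact_mod_cast card_pos.2 ⟨w, by simp [hyw, hwz]⟩

theorem b_pos {i : ℕ} (hi : i < Γ.diam) : 0 < b Γ i := by
  obtain ⟨y, z, h⟩ := exists_dist_eq hΓ.1 (Nat.succ_le_of_lt hi)
  obtain ⟨w, hyw, hwz⟩ := exists_adj_dist hΓ.1 h
  rw [b, ← hwz, ← hΓ.card_filter_eq_intersectionNumber 1 _ w z, hwz]
  exact_mod_cast card_pos.2 ⟨y, by simp [SimpleGraph.dist_comm (u := w), hyw, h]⟩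

theorem c_one (h : 1 ≤ Γ.diam) : c Γ 1 = 1 := by
  obtain ⟨y, z, h⟩ := exists_dist_eq hΓ.1 h
  have hcount := hΓ.card_filter_eq_intersectionNumber 1 0 y z
  have hcard : #{w | Γ.dist y w = 1 ∧ Γ.dist w z = 0} = 1 := by
    refine card_eq_one.2 ⟨z, ?_⟩
    ext w
    simp only [mem_filter, mem_univ, true_and, mem_singleton, hΓ.1.dist_eq_zero_iff]
    exact ⟨And.right, by rintro rfl; exact ⟨h, rfl⟩⟩
  rw [hcard, h] at hcount
  rw [c]
  exact_mod_cast hcount.symm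

theorem sum_filter_dist_eq_one (hb : Γ.IsBipartite) {M : Type*} [AddCommGroup M] [Module ℝ M]
    (F : ℕ → M) (y z : X) :
    ∑ w with Γ.dist y w = 1, F (Γ.dist w z) =
      c Γ (Γ.dist y z) • F (Γ.dist y z - 1) + b Γ (Γ.dist y z) • F (Γ.dist y z + 1) := by
  have hfar : ∑ w with Γ.dist y w = 1 ∧ Γ.dist w z = Γ.dist y z + 1, F (Γ.dist w z) =
      b Γ (Γ.dist y z) • F (Γ.dist y z + 1) := by
    rw [sum_congr rfl fun w hw => by rw [(mem_filter.1 hw).2.2], sum_const,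
      hΓ.card_filter_eq_intersectionNumber, b, Nat.cast_smul_eq_nsmul]
  have hnear : ∑ w with Γ.dist y w = 1 ∧ ¬ Γ.dist w z = Γ.dist y z + 1, F (Γ.dist w z) =
      c Γ (Γ.dist y z) • F (Γ.dist y z - 1) := by
    have hdist : ∀ w, (Γ.dist y w = 1 ∧ ¬ Γ.dist w z = Γ.dist y z + 1) ↔
        Γ.dist y w = 1 ∧ Γ.dist w z + 1 = Γ.dist y z := fun w => by
      refine and_congr_right fun hw => ?_
      have := dist_eq_or_eq_of_dist_eq_one hΓ.1 hb z hw
      omega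
    simp only [hdist]
    rcases h : Γ.dist y z with _ | m
    · simp [c_zero]
    · simp only [Nat.add_right_cancel_iff, Nat.add_sub_cancel]
      rw [sum_congr rfl fun w hw => by rw [(mem_filter.1 hw).2.2], sum_const,
        hΓ.card_filter_eq_intersectionNumber, h, c, Nat.cast_smul_eq_nsmul]
  rw [← sum_filter_add_sum_filter_not _ (fun w => Γ.dist w z = Γ.dist y z + 1), filter_filter,
    filter_filter, hfar, hnear, add_comm]

theorem card_filter_dist_eq_one (hb : Γ.IsBipartite) (y : X) :
    (#{w | Γ.dist y w = 1} : ℝ) = b Γ 0 := by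
  have h := hΓ.sum_filter_dist_eq_one hb (fun _ => (1 : ℝ)) y y
  simpa [c_zero] using h

theorem b_add_c (hb : Γ.IsBipartite) {i : ℕ} (hi : i ≤ Γ.diam) : b Γ i + c Γ i = b Γ 0 := by
  obtain ⟨y, z, rfl⟩ := exists_dist_eq hΓ.1 hi
  have h := hΓ.sum_filter_dist_eq_one hb (fun _ => (1 : ℝ)) y z
  rw [sum_const, nsmul_one, hΓ.card_filter_dist_eq_one hb, smul_eq_mul, smul_eq_mul] at h
  linarith

-- Double counting of the edges between the spheres of radii `i` and `i + 1`.
theorem kk_mul_b (i : ℕ) : kk Γ i * b Γ i = kk Γ (i + 1) * c Γ (i + 1) := by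
  obtain ⟨z⟩ := hΓ.1.nonempty
  have hcount := sum_card_bipartiteAbove_eq_sum_card_bipartiteBelow
    (s := {w | Γ.dist w z = i}) (t := {w | Γ.dist w z = i + 1}) (fun u w => Γ.dist u w = 1)
  have habove : ∀ u ∈ ({w | Γ.dist w z = i} : Finset X),
      #(bipartiteAbove (fun u w => Γ.dist u w = 1) {w | Γ.dist w z = i + 1} u) =
        intersectionNumber Γ i 1 (i + 1) := by
    intro u hu
    rw [← (mem_filter.1 hu).2, ← hΓ.card_filter_eq_intersectionNumber, bipartiteAbove,
      filter_filter, (mem_filter.1 hu).2]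
    simp only [and_comm]
  have hbelow : ∀ u ∈ ({w | Γ.dist w z = i + 1} : Finset X),
      #(bipartiteBelow (fun u w => Γ.dist u w = 1) {w | Γ.dist w z = i} u) =
        intersectionNumber Γ (i + 1) 1 i := by
    intro u hu
    rw [← (mem_filter.1 hu).2, ← hΓ.card_filter_eq_intersectionNumber, bipartiteBelow,
      filter_filter]
    simp only [and_comm, SimpleGraph.dist_comm (v := u)]
  rw [sum_congr rfl habove, sum_congr rfl hbelow, sum_const, sum_const, smul_eq_mul,
    smul_eq_mul] at hcount
  rw [← hΓ.card_filter_dist_eq i z, ← hΓ.card_filter_dist_eq (i + 1) z, b, c]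
  exact_mod_cast hcount

end IsDistanceRegular

section Polynomials

variable {X : Type*} [Fintype X] {Γ : SimpleGraph X}

theorem sum_filter_even_sub_add_two {M : Type*} [AddCommMonoid M] (F : ℕ → M) (i : ℕ) :
    ∑ h ∈ range (i + 2 + 1) with Even (i + 2 - h), F h =
      F (i + 2) + ∑ h ∈ range (i + 1) with Even (i - h), F h := by
  rw [range_add_one, filter_insert, if_pos (by simp), sum_insert (by simp), range_add_one,
    filter_insert, if_neg (by simp)]
  congr 2
  refine filter_congr fun h hh => ?_
  rw [Nat.sub_add_comm (Nat.lt_succ_iff.1 (mem_range.1 hh)), Nat.even_add]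
  simp

theorem filter_even_one_sub : {h ∈ range (1 + 1) | Even (1 - h)} = {1} := by
  decide

theorem p_zero : p Γ 0 = 1 := by
  simp [p, f]

theorem p_one : p Γ 1 = f Γ 1 := by
  rw [p, filter_even_one_sub, sum_singleton]

theorem p_add_two (i : ℕ) : p Γ (i + 2) = f Γ (i + 2) + p Γ i :=
  sum_filter_even_sub_add_two _ _

namespace IsDistanceRegular

variable (hΓ : IsDistanceRegular Γ)

include hΓ

theorem f_one (hD : 1 ≤ Γ.diam) : f Γ 1 = Polynomial.X := by
  simp [f, hΓ.c_one hD]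

theorem X_mul_f {i : ℕ} (hi : i + 2 ≤ Γ.diam) :
    Polynomial.X * f Γ (i + 1) = C (b Γ i) * f Γ i + C (c Γ (i + 2)) * f Γ (i + 2) := by
  have hc := (hΓ.c_pos (by omega) hi).ne'
  rw [f, ← mul_assoc, ← C_mul, mul_inv_cancel₀ hc, C_1, one_mul, add_sub_cancel]

theorem X_mul_p (hb : Γ.IsBipartite) {i : ℕ} (hi : i + 2 ≤ Γ.diam) :
    Polynomial.X * p Γ (i + 1) = C (c Γ (i + 2)) * p Γ (i + 2) + C (b Γ (i + 2)) * p Γ i := by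
  have hbc : ∀ j ≤ Γ.diam, C (b Γ j) + C (c Γ j) = C (b Γ 0) := fun j hj => by
    rw [← C_add, hΓ.b_add_c hb hj]
  induction i using Nat.twoStepInduction with
  | zero =>
    rw [p_one, hΓ.X_mul_f hi, p_add_two, p_zero, f]
    linear_combination -hbc 2 hi
  | one =>
    have hc : C (c Γ 1) = 1 := by rw [hΓ.c_one (by omega), C_1]
    rw [p_add_two 0, mul_add, hΓ.X_mul_f hi, p_add_two 1, p_zero, p_one, ← hΓ.f_one (by omega)]
    linear_combination f Γ 1 * (hbc 1 (by omega) - hbc 3 (by omega) - hc)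
  | more i ih _ =>
    rw [p_add_two (i + 1), mul_add, ih (by omega), hΓ.X_mul_f hi, p_add_two (i + 2), p_add_two i]
    linear_combination (f Γ (i + 2) + p Γ i) * (hbc (i + 2) (by omega) - hbc (i + 4) (by omega))

theorem g_zero (hD : 2 ≤ Γ.diam) (θ : ℝ) : g Γ θ 0 = 1 := by
  have hb₀ := (hΓ.b_pos (i := 0) (by omega)).ne'
  have hb₁ := (hΓ.b_pos (i := 1) (by omega)).ne'
  simp [g, p_zero, hΓ.kk_zero, hb₀, hb₁]

theorem g_one (hD : 3 ≤ Γ.diam) {θ : ℝ} (hθ : θ ≠ 0) : g Γ θ 1 = Polynomial.X := by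
  have hb₁ := (hΓ.b_pos (i := 1) (by omega)).ne'
  have hb₂ := (hΓ.b_pos (i := 2) (by omega)).ne'
  have hk := (hΓ.kk_pos (i := 1) (by omega)).ne'
  rw [g, filter_even_one_sub, sum_singleton, p_one, hΓ.f_one (by omega), eval_X,
    div_self (by positivity), C_1, one_mul]

theorem g_add_two {θ : ℝ} {i : ℕ} (hi : i + 4 ≤ Γ.diam)
    (h₀ : (p Γ i).eval θ ≠ 0) (h₂ : (p Γ (i + 2)).eval θ ≠ 0) :
    g Γ θ (i + 2) = p Γ (i + 2) +
      C ((p Γ i).eval θ * b Γ (i + 2) * b Γ (i + 3) /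
        ((p Γ (i + 2)).eval θ * c Γ (i + 1) * c Γ (i + 2))) * g Γ θ i := by
  have hb : ∀ j < Γ.diam, b Γ j ≠ 0 := fun j hj => (hΓ.b_pos hj).ne'
  have hk : ∀ j ≤ Γ.diam, kk Γ j ≠ 0 := fun j hj => (hΓ.kk_pos hj).ne'
  have hb₀ := hb i (by omega)
  have hb₁ := hb (i + 1) (by omega)
  have hb₂ := hb (i + 2) (by omega)
  have hb₃ := hb (i + 3) (by omega)
  have hk₀ := hk i (by omega)
  have hk₂ := hk (i + 2) (by omega)
  have hc₁ := (hΓ.c_pos (i := i + 1) (by omega) (by omega)).ne'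
  have hc₂ := (hΓ.c_pos (i := i + 2) (by omega) (by omega)).ne'
  have hkk : kk Γ (i + 2) = kk Γ i * b Γ i * b Γ (i + 1) / (c Γ (i + 1) * c Γ (i + 2)) := by
    rw [eq_div_iff (by positivity)]
    linear_combination -c Γ (i + 1) * hΓ.kk_mul_b (i + 1) - b Γ (i + 1) * hΓ.kk_mul_b i
  rw [g, sum_filter_even_sub_add_two, div_self (by positivity), C_1, one_mul, g, mul_sum]
  congr 1
  refine sum_congr rfl fun h hh => ?_
  have hhi : h ≤ i := Nat.lt_succ_iff.1 (mem_range.1 (mem_filter.1 hh).1)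
  have hb_h := hb h (by omega)
  have hb_h₁ := hb (h + 1) (by omega)
  have hk_h := hk h (by omega)
  rw [← mul_assoc, ← C_mul, hkk]
  congr 2
  field_simp

end IsDistanceRegular

end Polynomials

section DistanceMatrices

variable {X : Type*} [Fintype X] {Γ : SimpleGraph X}

theorem distMatrix_mulVec_apply (i : ℕ) (v : X → ℂ) (y : X) :
    (distMatrix Γ i *ᵥ v) y = ∑ w with Γ.dist y w = i, v w := by
  simp [mulVec, dotProduct, distMatrix, sum_filter]

theorem distMatrix_mul_apply (i : ℕ) (N : Matrix X X ℂ) (y z : X) :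
    (distMatrix Γ i * N) y z = ∑ w with Γ.dist y w = i, N w z := by
  simp [mul_apply, distMatrix, sum_filter]

namespace IsDistanceRegular

variable (hΓ : IsDistanceRegular Γ)

include hΓ

theorem adj_mul_apply (hb : Γ.IsBipartite) {F : ℕ → ℂ} {N : Matrix X X ℂ}
    (hN : ∀ y z, N y z = F (Γ.dist y z)) (y z : X) :
    (distMatrix Γ 1 * N) y z =
      c Γ (Γ.dist y z) • F (Γ.dist y z - 1) + b Γ (Γ.dist y z) • F (Γ.dist y z + 1) := by
  simp only [distMatrix_mul_apply, hN, hΓ.sum_filter_dist_eq_one hb F]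

theorem distMatrix_eq_zero {i : ℕ} (hi : Γ.diam < i) : distMatrix Γ i = 0 := by
  ext y z
  exact if_neg ((dist_le_diam_of_connected hΓ.1 y z).trans_lt hi).ne

theorem adj_mul_distMatrix (hb : Γ.IsBipartite) (i : ℕ) :
    distMatrix Γ 1 * distMatrix Γ (i + 1) =
      b Γ i • distMatrix Γ i + c Γ (i + 2) • distMatrix Γ (i + 2) := by
  ext y z
  rw [hΓ.adj_mul_apply hb (N := distMatrix Γ (i + 1))
    (F := fun j => if j = i + 1 then 1 else 0) (fun _ _ => rfl)]
  simp only [distMatrix, Matrix.add_apply, Matrix.smul_apply, of_apply]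
  obtain h | h | ⟨h₀, h₁, h₂⟩ : Γ.dist y z = i ∨ Γ.dist y z = i + 2 ∨
      (Γ.dist y z ≠ i ∧ Γ.dist y z ≠ i + 2 ∧ Γ.dist y z - 1 ≠ i + 1) := by omega
  · have hne : i - 1 ≠ i + 1 := by omega
    simp [h, hne]
  · simp [h]
  · simp [h₀, h₁, h₂]

theorem eq_sum_distMatrix {F : ℕ → ℝ} {N : Matrix X X ℂ} (hN : ∀ y z, N y z = F (Γ.dist y z)) :
    N = ∑ i : Fin (Γ.diam + 1), F i • distMatrix Γ i := by
  ext y z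
  have hlt := Nat.lt_succ_of_le (dist_le_diam_of_connected hΓ.1 y z)
  rw [hN, Matrix.sum_apply, sum_eq_single ⟨Γ.dist y z, hlt⟩]
  · simp [distMatrix]
  · intro i _ hi
    have hne : Γ.dist y z ≠ i := fun h => hi (Fin.ext h.symm)
    simp [distMatrix, hne]
  · simp

theorem linearIndependent_distMatrix :
    LinearIndependent ℝ fun i : Fin (Γ.diam + 1) => distMatrix Γ i := by
  refine Fintype.linearIndependent_iff.2 fun a ha i => ?_
  obtain ⟨y, z, hyz⟩ := exists_dist_eq hΓ.1 (Nat.lt_succ_iff.1 i.2)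
  have h := congrFun (congrFun ha y) z
  rw [Matrix.sum_apply, sum_eq_single i (fun j _ hj => ?_) (by simp)] at h
  · simpa [distMatrix, hyz] using h
  · have hne : Γ.dist y z ≠ j := fun h => hj (Fin.ext (h.symm.trans hyz))
    simp [distMatrix, hne]

theorem distMatrix_mul_self_apply (i : ℕ) (y : X) :
    (distMatrix Γ i * distMatrix Γ i) y y = (kk Γ i : ℂ) := by
  rw [← hΓ.card_filter_dist_eq i y, distMatrix_mul_apply]
  simp [distMatrix, SimpleGraph.dist_comm (u := y), Finset.filter_true_of_mem]

variable [DecidableEq X]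

theorem distMatrix_zero : distMatrix Γ 0 = 1 := by
  ext y z
  simp [distMatrix, one_apply, hΓ.1.dist_eq_zero_iff]

theorem aeval_f (hb : Γ.IsBipartite) {i : ℕ} (hi : i ≤ Γ.diam) :
    aeval (distMatrix Γ 1) (f Γ i) = distMatrix Γ i := by
  induction i using Nat.twoStepInduction with
  | zero => rw [f, map_one, hΓ.distMatrix_zero]
  | one => rw [hΓ.f_one hi, aeval_X]
  | more i ih₀ ih₁ =>
    have hc := (hΓ.c_pos (by omega) hi).ne'
    rw [f, map_mul, map_sub, map_mul, map_mul, aeval_X, aeval_C, aeval_C, ih₀ (by omega),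
      ih₁ (by omega), hΓ.adj_mul_distMatrix hb, ← Algebra.smul_def, ← Algebra.smul_def,
      add_sub_cancel_left, smul_smul, inv_mul_cancel₀ hc, one_smul]

theorem exists_aeval_apply_eq (hb : Γ.IsBipartite) (q : ℝ[X]) :
    ∃ F : ℕ → ℝ, ∀ y z, aeval (distMatrix Γ 1) q y z = F (Γ.dist y z) := by
  induction q using Polynomial.induction_on' with
  | add q r hq hr =>
    obtain ⟨F, hF⟩ := hq
    obtain ⟨G, hG⟩ := hr
    exact ⟨F + G, fun y z => by simp [hF, hG]⟩
  | monomial n a =>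
    induction n with
    | zero =>
      refine ⟨fun j => if j = 0 then a else 0, fun y z => ?_⟩
      rw [monomial_zero_left, aeval_C, Algebra.algebraMap_eq_smul_one, ← hΓ.distMatrix_zero]
      simp only [distMatrix, Matrix.smul_apply, of_apply]
      split_ifs <;> simp
    | succ n ih =>
      obtain ⟨F, hF⟩ := ih
      refine ⟨fun j => c Γ j * F (j - 1) + b Γ j * F (j + 1), fun y z => ?_⟩
      rw [← X_mul_monomial, map_mul, aeval_X, hΓ.adj_mul_apply hb (F := fun j => F j) hF]
      push_cast
      simp only [Complex.real_smul]

end IsDistanceRegular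

end DistanceMatrices

section Spectrum

theorem aeval_mul_of_mul_eq_smul {R A : Type*} [CommRing R] [Ring A] [Algebra R A] {a e : A}
    {t : R} (h : a * e = t • e) (q : R[X]) : aeval a q * e = q.eval t • e := by
  induction q using Polynomial.induction_on' with
  | add q r hq hr => rw [map_add, add_mul, hq, hr, eval_add, add_smul]
  | monomial n r =>
    induction n with
    | zero => rw [monomial_zero_left, aeval_C, eval_C, Algebra.smul_def]
    | succ n ih =>
      rw [← X_mul_monomial, map_mul, aeval_X, mul_assoc, ih, mul_smul_comm, h, smul_smul,
        eval_mul, eval_X, mul_comm]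

variable {X : Type*} [Fintype X] [DecidableEq X] {Γ : SimpleGraph X}

/-- The finite set of eigenvalues of the adjacency matrix. -/
noncomputable def spec (Γ : SimpleGraph X) : Finset ℝ :=
  (finite_eigenvalues Γ).toFinset

/-- The matrix of the orthogonal projection onto the eigenspace of the adjacency matrix for `t`,
so that `E_i` is `eigenProj Γ θ_i`. -/
noncomputable def eigenProj (Γ : SimpleGraph X) (t : ℝ) : Matrix X X ℂ :=
  Matrix.toEuclideanLin.symm
    ((Module.End.eigenspace (adjOp Γ) (t : ℂ)).starProjection :
      EuclideanSpace ℂ X →ₗ[ℂ] EuclideanSpace ℂ X)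

theorem primIdem_eq_eigenProj (Γ : SimpleGraph X) (i : ℕ) :
    primIdem Γ i = eigenProj Γ (eigenvalue Γ i) := rfl

theorem mem_spec_iff {t : ℝ} : t ∈ spec Γ ↔ Module.End.HasEigenvalue (adjOp Γ) (t : ℂ) :=
  (finite_eigenvalues Γ).mem_toFinset

theorem mem_eigenspace_adjOp_iff {t : ℂ} {w : EuclideanSpace ℂ X} :
    w ∈ Module.End.eigenspace (adjOp Γ) t ↔ distMatrix Γ 1 *ᵥ w.ofLp = t • w.ofLp := by
  rw [Module.End.mem_eigenspace_iff, ← (WithLp.ofLp_injective 2).eq_iff]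
  rfl

theorem mem_spec_iff_exists {t : ℝ} :
    t ∈ spec Γ ↔ ∃ w : X → ℂ, w ≠ 0 ∧ distMatrix Γ 1 *ᵥ w = (t : ℂ) • w := by
  rw [mem_spec_iff]
  constructor
  · intro h
    obtain ⟨w, hw, hw0⟩ := h.exists_hasEigenvector
    exact ⟨w.ofLp, fun h => hw0 (WithLp.ofLp_injective 2 h), mem_eigenspace_adjOp_iff.1 hw⟩
  · rintro ⟨w, hw0, hw⟩
    refine Module.End.hasEigenvalue_of_hasEigenvector (x := WithLp.toLp 2 w)
      ⟨mem_eigenspace_adjOp_iff.2 hw, fun h => hw0 (congrArg WithLp.ofLp h)⟩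

theorem eigenProj_mulVec (t : ℝ) (w : X → ℂ) :
    eigenProj Γ t *ᵥ w =
      ((Module.End.eigenspace (adjOp Γ) (t : ℂ)).starProjection (WithLp.toLp 2 w)).ofLp := by
  have h : Matrix.toEuclideanLin (eigenProj Γ t) (WithLp.toLp 2 w) =
      (Module.End.eigenspace (adjOp Γ) (t : ℂ)).starProjection (WithLp.toLp 2 w) := by
    rw [eigenProj, LinearEquiv.apply_symm_apply]
    rfl
  exact congrArg WithLp.ofLp h

theorem adj_mul_eigenProj (t : ℝ) : distMatrix Γ 1 * eigenProj Γ t = t • eigenProj Γ t := by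
  refine Matrix.ext_of_mulVec_single fun i => ?_
  rw [← mulVec_mulVec, smul_mulVec, eigenProj_mulVec]
  exact mem_eigenspace_adjOp_iff.1 (Submodule.starProjection_apply_mem _ _)

theorem eigenProj_ne_zero {t : ℝ} (ht : t ∈ spec Γ) : eigenProj Γ t ≠ 0 := by
  intro h
  obtain ⟨w, hw0, hw⟩ := mem_spec_iff_exists.1 ht
  refine hw0 ?_
  have hproj := eigenProj_mulVec (Γ := Γ) t w
  rw [Submodule.starProjection_eq_self_iff.2 (mem_eigenspace_adjOp_iff.2 hw), h, zero_mulVec]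
    at hproj
  exact hproj.symm

theorem star_dotProduct_eigenProj_mulVec (t : ℝ) (w : X → ℂ) :
    star w ⬝ᵥ (eigenProj Γ t *ᵥ w) =
      ((‖(Module.End.eigenspace (adjOp Γ) (t : ℂ)).starProjection (WithLp.toLp 2 w)‖ ^ 2 : ℝ) :
        ℂ) := by
  set U := Module.End.eigenspace (adjOp Γ) (t : ℂ)
  have hinner : star w ⬝ᵥ (eigenProj Γ t *ᵥ w) =
      inner ℂ (WithLp.toLp 2 w) (U.starProjection (WithLp.toLp 2 w)) := by
    rw [EuclideanSpace.inner_eq_star_dotProduct, eigenProj_mulVec, dotProduct_comm]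
  have hidem : U.starProjection (U.starProjection (WithLp.toLp 2 w)) =
      U.starProjection (WithLp.toLp 2 w) :=
    Submodule.starProjection_eq_self_iff.2 (Submodule.starProjection_apply_mem _ _)
  rw [hinner, ← hidem, ← Submodule.inner_starProjection_left_eq_right,
    inner_self_eq_norm_sq_to_K, hidem]
  simp

theorem eigenProj_mulVec_eq_zero_iff {t : ℝ} {w : X → ℂ} :
    eigenProj Γ t *ᵥ w = 0 ↔ star w ⬝ᵥ (eigenProj Γ t *ᵥ w) = 0 := by
  refine ⟨fun h => by rw [h, dotProduct_zero], fun h => ?_⟩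
  rw [star_dotProduct_eigenProj_mulVec, Complex.ofReal_eq_zero, sq_eq_zero_iff, norm_eq_zero] at h
  rw [eigenProj_mulVec, h]
  rfl

theorem adjOp_isSymmetric (Γ : SimpleGraph X) : (adjOp Γ).IsSymmetric := by
  rw [adjOp, Matrix.isSymmetric_toEuclideanLin_iff]
  ext y z
  rw [conjTranspose_apply, distMatrix, of_apply, of_apply, SimpleGraph.dist_comm]
  split_ifs <;> simp

theorem iSup_eigenspace_spec (Γ : SimpleGraph X) :
    ⨆ t : spec Γ, Module.End.eigenspace (adjOp Γ) ((t : ℝ) : ℂ) = ⊤ := by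
  have hT := adjOp_isSymmetric Γ
  rw [← Submodule.orthogonal_eq_bot_iff, eq_bot_iff,
    ← hT.orthogonalComplement_iSup_eigenspaces_eq_bot]
  refine Submodule.orthogonal_le (iSup_le fun μ => ?_)
  by_cases hμ : Module.End.HasEigenvalue (adjOp Γ) μ
  · have hre : (μ.re : ℂ) = μ := Complex.conj_eq_iff_re.1 (hT.conj_eigenvalue_eq_self hμ)
    have hmem : μ.re ∈ spec Γ := mem_spec_iff.2 (by rwa [hre])
    rw [← hre]
    exact le_iSup (fun t : spec Γ => Module.End.eigenspace (adjOp Γ) ((t : ℝ) : ℂ)) ⟨_, hmem⟩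
  · rw [Module.End.hasEigenvalue_iff, not_not] at hμ
    exact hμ ▸ bot_le

theorem sum_eigenProj (Γ : SimpleGraph X) : ∑ t ∈ spec Γ, eigenProj Γ t = 1 := by
  refine Matrix.ext_of_mulVec_single fun i => ?_
  have horth : OrthogonalFamily ℂ
      (fun t : spec Γ => Module.End.eigenspace (adjOp Γ) ((t : ℝ) : ℂ))
      fun t => (Module.End.eigenspace (adjOp Γ) ((t : ℝ) : ℂ)).subtypeₗᵢ :=
    (adjOp_isSymmetric Γ).orthogonalFamily_eigenspaces.comp
      (f := fun t : spec Γ => ((t : ℝ) : ℂ))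
      (Complex.ofReal_injective.comp Subtype.val_injective)
  have hsum := horth.sum_projection_of_mem_iSup (WithLp.toLp 2 (Pi.single i 1))
    (iSup_eigenspace_spec Γ ▸ Submodule.mem_top)
  rw [sum_mulVec, one_mulVec, ← sum_coe_sort]
  simp only [eigenProj_mulVec]
  simpa only [WithLp.ofLp_sum] using congrArg WithLp.ofLp hsum

theorem aeval_eq_sum_eigenProj (Γ : SimpleGraph X) (q : ℝ[X]) :
    aeval (distMatrix Γ 1) q = ∑ t ∈ spec Γ, q.eval t • eigenProj Γ t := by
  rw [← mul_one (aeval (distMatrix Γ 1) q), ← sum_eigenProj, mul_sum]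
  exact sum_congr rfl fun t _ => aeval_mul_of_mul_eq_smul (adj_mul_eigenProj t) q

theorem exists_aeval_eq_eigenProj {t : ℝ} (ht : t ∈ spec Γ) :
    ∃ q : ℝ[X], aeval (distMatrix Γ 1) q = eigenProj Γ t := by
  refine ⟨Lagrange.basis (spec Γ) id t, ?_⟩
  rw [aeval_eq_sum_eigenProj, sum_eq_single_of_mem t ht fun s hs hst => ?_]
  · have h := Lagrange.eval_basis_self (Set.injOn_id (spec Γ : Set ℝ)) ht
    rw [id] at h
    rw [h, one_smul]
  · have h := Lagrange.eval_basis_of_ne (v := id) hst.symm hs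
    rw [id] at h
    rw [h, zero_smul]

theorem linearIndependent_eigenProj (Γ : SimpleGraph X) :
    LinearIndependent ℝ fun t : spec Γ => eigenProj Γ t :=
  Module.End.eigenvectors_linearIndependent' (LinearMap.mulLeft ℝ (distMatrix Γ 1)) _
    Subtype.val_injective _ fun t =>
      ⟨Module.End.mem_eigenspace_iff.2 (adj_mul_eigenProj _), eigenProj_ne_zero t.2⟩

namespace IsDistanceRegular

variable (hΓ : IsDistanceRegular Γ) (hb : Γ.IsBipartite)

include hΓ hb

theorem exists_eigenProj_apply_eq {t : ℝ} (ht : t ∈ spec Γ) :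
    ∃ F : ℕ → ℝ, F 0 ≠ 0 ∧ (∀ y z, eigenProj Γ t y z = F (Γ.dist y z)) ∧
      ∀ i ≤ Γ.diam, c Γ i * F (i - 1) + b Γ i * F (i + 1) = t * F i := by
  obtain ⟨q, hq⟩ := exists_aeval_eq_eigenProj ht
  obtain ⟨F, hF⟩ := hΓ.exists_aeval_apply_eq hb q
  rw [hq] at hF
  have hrec : ∀ i ≤ Γ.diam, c Γ i * F (i - 1) + b Γ i * F (i + 1) = t * F i := by
    intro i hi
    obtain ⟨y, z, rfl⟩ := exists_dist_eq hΓ.1 hi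
    have h := congrFun (congrFun (adj_mul_eigenProj (Γ := Γ) t) y) z
    rw [hΓ.adj_mul_apply hb (F := fun j => F j) hF, Matrix.smul_apply, hF] at h
    simp only [Complex.real_smul] at h
    exact_mod_cast h
  refine ⟨F, fun h0 => eigenProj_ne_zero ht ?_, hF, hrec⟩
  have hF0 : ∀ i ≤ Γ.diam, F i = 0 := by
    intro i
    induction i using Nat.twoStepInduction with
    | zero => exact fun _ => h0
    | one =>
      intro hi
      have h := hrec 0 (by omega)
      rw [h0, c_zero, zero_mul, mul_zero, zero_add] at h
      exact (mul_eq_zero.1 h).resolve_left (hΓ.b_pos (by omega)).ne'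
    | more i ih₀ ih₁ =>
      intro hi
      have h := hrec (i + 1) (by omega)
      rw [ih₁ (by omega), Nat.add_sub_cancel, ih₀ (by omega), mul_zero, mul_zero, zero_add] at h
      exact (mul_eq_zero.1 h).resolve_left (hΓ.b_pos (by omega)).ne'
  ext y z
  rw [hF, hF0 _ (dist_le_diam_of_connected hΓ.1 y z), Complex.ofReal_zero, Matrix.zero_apply]

-- The distance matrices and the projections `eigenProj Γ t` are two bases of the same algebra.
theorem card_spec : #(spec Γ) = Γ.diam + 1 := by
  apply le_antisymm
  · have hspan : Set.range (fun t : spec Γ => eigenProj Γ t) ⊆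
        Submodule.span ℝ (Set.range fun i : Fin (Γ.diam + 1) => distMatrix Γ i) := by
      rintro _ ⟨t, rfl⟩
      obtain ⟨F, -, hF, -⟩ := hΓ.exists_eigenProj_apply_eq hb t.2
      simp only [hΓ.eq_sum_distMatrix hF, SetLike.mem_coe]
      exact sum_mem fun i _ => Submodule.smul_mem _ _ (Submodule.subset_span ⟨i, rfl⟩)
    have h := linearIndependent_le_span' _ (linearIndependent_eigenProj Γ) _ hspan
    rw [Cardinal.mk_fintype, Nat.cast_le, Fintype.card_coe] at h
    exact h.trans ((Fintype.card_range_le _).trans_eq (Fintype.card_fin _))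
  · have hspan : Set.range (fun i : Fin (Γ.diam + 1) => distMatrix Γ i) ⊆
        Submodule.span ℝ (Set.range fun t : spec Γ => eigenProj Γ t) := by
      rintro _ ⟨i, rfl⟩
      simp only [← hΓ.aeval_f hb (Nat.lt_succ_iff.1 i.2), aeval_eq_sum_eigenProj]
      exact sum_mem fun t ht => Submodule.smul_mem _ _ (Submodule.subset_span ⟨⟨t, ht⟩, rfl⟩)
    have h := linearIndependent_le_span' _ hΓ.linearIndependent_distMatrix _ hspan
    rw [Cardinal.mk_fintype, Nat.cast_le, Fintype.card_fin] at h
    exact h.trans ((Fintype.card_range_le _).trans_eq (Fintype.card_coe _))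

theorem neg_mem_spec {t : ℝ} (ht : t ∈ spec Γ) : -t ∈ spec Γ := by
  obtain ⟨x⟩ := hΓ.1.nonempty
  rw [mem_spec_iff_exists] at ht ⊢
  obtain ⟨w, hw0, hw⟩ := ht
  refine ⟨fun y => (-1) ^ Γ.dist y x * w y, fun h => hw0 ?_, ?_⟩
  · ext y
    simpa using congrFun h y
  · ext y
    have hwy := congrFun hw y
    simp only [distMatrix_mulVec_apply, Pi.smul_apply, smul_eq_mul] at hwy ⊢
    rw [Complex.ofReal_neg, neg_mul, mul_left_comm, ← hwy, mul_sum, ← sum_neg_distrib]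
    refine sum_congr rfl fun z hz => ?_
    rcases dist_eq_or_eq_of_dist_eq_one hΓ.1 hb x (mem_filter.1 hz).2 with h | h
    · rw [h, pow_succ]
      ring
    · rw [← h, pow_succ]
      ring

theorem b_zero_mem_spec : b Γ 0 ∈ spec Γ := by
  obtain ⟨x⟩ := hΓ.1.nonempty
  refine mem_spec_iff_exists.2 ⟨fun _ => 1, fun h => one_ne_zero (congrFun h x), ?_⟩
  ext y
  simp [distMatrix_mulVec_apply, ← hΓ.card_filter_dist_eq_one hb y]

theorem abs_le_of_mem_spec {t : ℝ} (ht : t ∈ spec Γ) : |t| ≤ b Γ 0 := by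
  obtain ⟨w, hw0, hw⟩ := mem_spec_iff_exists.1 ht
  obtain ⟨y, hy⟩ := eigenvalue_mem_ball (A := distMatrix Γ 1) (μ := (t : ℂ))
    (Module.End.hasEigenvalue_of_hasEigenvector
      ⟨Module.End.mem_eigenspace_iff.2 hw, hw0⟩)
  have hdiag : distMatrix Γ 1 y y = 0 := by simp [distMatrix]
  rw [hdiag, mem_closedBall_zero_iff, Complex.norm_real, Real.norm_eq_abs] at hy
  calc |t| ≤ ∑ z ∈ univ.erase y, ‖distMatrix Γ 1 y z‖ := hy
    _ ≤ ∑ z, ‖distMatrix Γ 1 y z‖ :=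
      sum_le_sum_of_subset_of_nonneg (erase_subset _ _) fun _ _ _ => norm_nonneg _
    _ = b Γ 0 := by
      rw [← hΓ.card_filter_dist_eq_one hb y]
      simp [distMatrix, apply_ite]

end IsDistanceRegular

end Spectrum

section EigenvalueOrdering

variable {X : Type*} [Fintype X] [DecidableEq X] {Γ : SimpleGraph X}

theorem eigenvalue_eq_getElem {j : ℕ} (hj : j < ((spec Γ).sort (fun s t => t ≤ s)).length) :
    eigenvalue Γ j = ((spec Γ).sort (fun s t => t ≤ s))[j] :=
  List.getD_eq_getElem _ _ hj

namespace IsDistanceRegular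

variable (hΓ : IsDistanceRegular Γ) (hb : Γ.IsBipartite)

include hΓ hb

theorem length_sort_spec : ((spec Γ).sort (fun s t => t ≤ s)).length = Γ.diam + 1 := by
  rw [length_sort, hΓ.card_spec hb]

theorem eigenvalue_mem_spec {j : ℕ} (hj : j ≤ Γ.diam) : eigenvalue Γ j ∈ spec Γ := by
  rw [eigenvalue_eq_getElem ((Nat.lt_succ_of_le hj).trans_eq (hΓ.length_sort_spec hb).symm),
    ← mem_sort (fun s t => t ≤ s)]
  exact List.getElem_mem _

theorem strictAntiOn_eigenvalue : StrictAntiOn (eigenvalue Γ) (Set.Iic Γ.diam) := by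
  intro i hi j hj hij
  have hlt : ∀ m ∈ Set.Iic Γ.diam, m < ((spec Γ).sort (fun s t => t ≤ s)).length :=
    fun m hm => (Nat.lt_succ_of_le hm).trans_eq (hΓ.length_sort_spec hb).symm
  rw [eigenvalue_eq_getElem (hlt i hi), eigenvalue_eq_getElem (hlt j hj)]
  refine lt_of_le_of_ne ?_ fun h => ?_
  · exact List.pairwise_iff_getElem.1 (pairwise_sort (spec Γ) (fun s t => t ≤ s)) i j _ _ hij
  · exact hij.ne' ((List.Nodup.getElem_inj_iff (sort_nodup (spec Γ) (fun s t => t ≤ s))).1 h)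

theorem image_eigenvalue : (range (Γ.diam + 1)).image (eigenvalue Γ) = spec Γ := by
  refine eq_of_subset_of_card_le (image_subset_iff.2 fun j hj => ?_) ?_
  · exact hΓ.eigenvalue_mem_spec hb (Nat.lt_succ_iff.1 (mem_range.1 hj))
  · rw [card_image_of_injOn, card_range, hΓ.card_spec hb]
    exact (hΓ.strictAntiOn_eigenvalue hb).injOn.mono fun j hj =>
      Nat.lt_succ_iff.1 (mem_range.1 hj)

theorem exists_eigenvalue_eq {t : ℝ} (ht : t ∈ spec Γ) : ∃ j ≤ Γ.diam, eigenvalue Γ j = t := by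
  rw [← hΓ.image_eigenvalue hb, mem_image] at ht
  obtain ⟨j, hj, rfl⟩ := ht
  exact ⟨j, Nat.lt_succ_iff.1 (mem_range.1 hj), rfl⟩

theorem eigenvalue_zero : eigenvalue Γ 0 = b Γ 0 := by
  obtain ⟨j, hj, hbj⟩ := hΓ.exists_eigenvalue_eq hb (hΓ.b_zero_mem_spec hb)
  refine le_antisymm ?_ ?_
  · exact (le_abs_self _).trans
      (hΓ.abs_le_of_mem_spec hb (hΓ.eigenvalue_mem_spec hb (Nat.zero_le _)))
  · rw [← hbj]
    exact (hΓ.strictAntiOn_eigenvalue hb).antitoneOn (Nat.zero_le Γ.diam) hj (Nat.zero_le _)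

-- Both `θ_{D-j}` and `-θ_j` enumerate the spectrum in increasing order.
theorem eigenvalue_sub {j : ℕ} (hj : j ≤ Γ.diam) :
    eigenvalue Γ (Γ.diam - j) = -eigenvalue Γ j := by
  have hanti := hΓ.strictAntiOn_eigenvalue hb
  have hle : ∀ i : Fin (Γ.diam + 1), (i : ℕ) ≤ Γ.diam := fun i => Nat.lt_succ_iff.1 i.2
  have hrev := orderEmbOfFin_unique (hΓ.card_spec hb)
    (f := fun i : Fin (Γ.diam + 1) => eigenvalue Γ (Γ.diam - i))
    (fun i => hΓ.eigenvalue_mem_spec hb (Nat.sub_le _ _)) fun i i' h =>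
      hanti (Nat.sub_le _ _) (Nat.sub_le _ _)
        (Nat.sub_lt_sub_left ((Fin.lt_def.1 h).trans_le (hle i')) h)
  have hneg := orderEmbOfFin_unique (hΓ.card_spec hb)
    (f := fun i : Fin (Γ.diam + 1) => -eigenvalue Γ i)
    (fun i => hΓ.neg_mem_spec hb (hΓ.eigenvalue_mem_spec hb (hle i))) fun i i' h =>
      neg_lt_neg (hanti (hle i) (hle i') h)
  exact congrFun (hrev.trans hneg.symm) ⟨j, Nat.lt_succ_of_le hj⟩

theorem eigenvalue_sq_eq_iff {i j : ℕ} (hi : i ≤ Γ.diam) (hj : j ≤ Γ.diam) :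
    eigenvalue Γ i ^ 2 = eigenvalue Γ j ^ 2 ↔ i = j ∨ i = Γ.diam - j := by
  have hinj := (hΓ.strictAntiOn_eigenvalue hb).injOn
  rw [sq_eq_sq_iff_eq_or_eq_neg, ← hΓ.eigenvalue_sub hb hj, hinj.eq_iff hi hj,
    hinj.eq_iff hi (Nat.sub_le _ _)]

theorem eigenvalue_pos {j : ℕ} (hj : 2 * j < Γ.diam) : 0 < eigenvalue Γ j := by
  have h := hΓ.strictAntiOn_eigenvalue hb (show j ≤ Γ.diam by omega)
    (Nat.sub_le Γ.diam j) (by omega)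
  rw [hΓ.eigenvalue_sub hb (by omega)] at h
  linarith

theorem eigenvalue_sq_lt {i j : ℕ} (hij : i < j) (hj : 2 * j ≤ Γ.diam) :
    eigenvalue Γ j ^ 2 < eigenvalue Γ i ^ 2 := by
  have hanti := hΓ.strictAntiOn_eigenvalue hb
  have hlt := hanti (show i ≤ Γ.diam by omega) (show j ≤ Γ.diam by omega) hij
  have hle := hanti.antitoneOn (show j ≤ Γ.diam by omega) (Nat.sub_le Γ.diam j) (by omega)
  rw [hΓ.eigenvalue_sub hb (by omega)] at hle
  exact sq_lt_sq' (by linarith) hlt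

theorem exists_eigenvalue_sq_eq {t : ℝ} (ht : t ∈ spec Γ) :
    ∃ j, 2 * j ≤ Γ.diam ∧ eigenvalue Γ j ^ 2 = t ^ 2 := by
  obtain ⟨j, hj, rfl⟩ := hΓ.exists_eigenvalue_eq hb ht
  by_cases h : 2 * j ≤ Γ.diam
  · exact ⟨j, h, rfl⟩
  · exact ⟨Γ.diam - j, by omega, by rw [hΓ.eigenvalue_sub hb hj, neg_sq]⟩

end IsDistanceRegular

end EigenvalueOrdering

section EigenvalueBounds

variable {X : Type*} [Fintype X] [DecidableEq X] {Γ : SimpleGraph X}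

namespace IsDistanceRegular

variable (hΓ : IsDistanceRegular Γ) (hb : Γ.IsBipartite)

include hΓ hb

theorem adj_mul_adj : distMatrix Γ 1 * distMatrix Γ 1 = b Γ 0 • 1 + c Γ 2 • distMatrix Γ 2 := by
  rw [hΓ.adj_mul_distMatrix hb 0, hΓ.distMatrix_zero]

theorem exists_eigenProj_apply_self_eq {t : ℝ} (ht : t ∈ spec Γ) (y : X) :
    ∃ r : ℝ, 0 < r ∧ eigenProj Γ t y y = r := by
  obtain ⟨F, hF0, hF, -⟩ := hΓ.exists_eigenProj_apply_eq hb ht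
  have hnorm := star_dotProduct_eigenProj_mulVec (Γ := Γ) t (Pi.single y 1)
  have hyy : eigenProj Γ t y y = F 0 := by rw [hF, SimpleGraph.dist_self]
  rw [Matrix.mulVec_single_one, ← Pi.single_star, star_one, single_one_dotProduct, col_apply, hyy,
    Complex.ofReal_inj] at hnorm
  exact ⟨F 0, hF0.symm.lt_of_le (hnorm ▸ sq_nonneg _), hyy⟩

theorem sum_spec_mul_eigenProj_apply_self (hD : 2 ≤ Γ.diam) (y : X) :
    ∑ t ∈ spec Γ, ((b Γ 0 ^ 2 - t ^ 2) * (t ^ 2 - b Γ 2)) • eigenProj Γ t y y = 0 := by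
  have h := congrFun (congrFun (aeval_eq_sum_eigenProj Γ
    ((C (b Γ 0 ^ 2) - Polynomial.X ^ 2) * (Polynomial.X ^ 2 - C (b Γ 2)))) y) y
  simp only [eval_mul, eval_sub, eval_C, eval_pow, eval_X, Matrix.sum_apply, Matrix.smul_apply]
    at h
  have hA : aeval (distMatrix Γ 1)
        ((C (b Γ 0 ^ 2) - Polynomial.X ^ 2) * (Polynomial.X ^ 2 - C (b Γ 2))) =
      ((b Γ 0 ^ 2 - b Γ 0) * (b Γ 0 - b Γ 2)) • (1 : Matrix X X ℂ) +
        (c Γ 2 * (b Γ 0 ^ 2 - b Γ 0) - c Γ 2 * (b Γ 0 - b Γ 2)) • distMatrix Γ 2 -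
        c Γ 2 ^ 2 • (distMatrix Γ 2 * distMatrix Γ 2) := by
    simp only [map_mul, map_sub, map_pow, aeval_X, aeval_C, _root_.smul_pow,
      one_pow, sq (distMatrix Γ 1),
      hΓ.adj_mul_adj hb, Algebra.algebraMap_eq_smul_one, sub_mul, add_mul, mul_sub, mul_add,
      smul_mul_assoc, mul_smul_comm, one_mul, mul_one]
    module
  have hoff : distMatrix Γ 2 y y = 0 := by simp [distMatrix]
  rw [← h, hA]
  simp only [Matrix.sub_apply, Matrix.add_apply, Matrix.smul_apply, one_apply_eq, hoff,
    hΓ.distMatrix_mul_self_apply, smul_zero, add_zero, Complex.real_smul, mul_one]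
  have hk₀ := hΓ.kk_mul_b 0
  have hk₁ := hΓ.kk_mul_b 1
  have hb₁ := hΓ.b_add_c hb (i := 1) (by omega)
  have hb₂ := hΓ.b_add_c hb hD
  rw [hΓ.kk_zero, hΓ.c_one (by omega)] at hk₀
  rw [hΓ.c_one (by omega)] at hb₁
  have hreal : (b Γ 0 ^ 2 - b Γ 0) * (b Γ 0 - b Γ 2) - c Γ 2 ^ 2 * kk Γ 2 = 0 := by
    linear_combination (-b Γ 0 * c Γ 2) * hb₁ + c Γ 2 * hk₁ +
      c Γ 2 * b Γ 1 * hk₀ - (b Γ 0 ^ 2 - b Γ 0) * hb₂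
  exact_mod_cast hreal

-- With the positive weights `E_t(y, y)`, the polynomial `(k² - t²)(t² - b₂)` has mean zero over the
-- spectrum, so it takes both signs.
theorem exists_sq_lt_b_two_and_exists_b_two_lt_sq (hD : 4 ≤ Γ.diam) :
    (∃ t ∈ spec Γ, t ^ 2 < b Γ 2) ∧ ∃ t ∈ spec Γ, b Γ 2 < t ^ 2 ∧ t ^ 2 < b Γ 0 ^ 2 := by
  obtain ⟨y⟩ := hΓ.1.nonempty
  choose! r hr0 hr using fun t ht => hΓ.exists_eigenProj_apply_self_eq hb (t := t) ht y
  have hsum : ∑ t ∈ spec Γ, (b Γ 0 ^ 2 - t ^ 2) * (t ^ 2 - b Γ 2) * r t = 0 := by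
    have h := hΓ.sum_spec_mul_eigenProj_apply_self hb (by omega) y
    rw [sum_congr rfl fun t ht => by rw [hr t ht, Complex.real_smul]] at h
    exact_mod_cast h
  have hle : ∀ t ∈ spec Γ, t ^ 2 ≤ b Γ 0 ^ 2 := fun t ht =>
    sq_le_sq.2 ((hΓ.abs_le_of_mem_spec hb ht).trans (le_abs_self _))
  have hne : ∃ t ∈ spec Γ, (b Γ 0 ^ 2 - t ^ 2) * (t ^ 2 - b Γ 2) * r t ≠ 0 := by
    have h₁ := hΓ.eigenvalue_sq_lt hb (i := 0) (j := 1) one_pos (by omega)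
    have h₂ := hΓ.eigenvalue_sq_lt hb (i := 1) (j := 2) one_lt_two (by omega)
    rw [hΓ.eigenvalue_zero hb] at h₁
    by_contra! hzero
    have hsq : ∀ j ≤ Γ.diam, eigenvalue Γ j ^ 2 < b Γ 0 ^ 2 → eigenvalue Γ j ^ 2 = b Γ 2 := by
      intro j hj hlt
      have hmem := hΓ.eigenvalue_mem_spec hb hj
      have h := (mul_eq_zero.1 (hzero _ hmem)).resolve_right (hr0 _ hmem).ne'
      exact sub_eq_zero.1 ((mul_eq_zero.1 h).resolve_left (sub_pos.2 hlt).ne')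
    exact h₂.ne ((hsq 2 (by omega) (h₂.trans h₁)).trans (hsq 1 (by omega) h₁).symm)
  constructor
  · obtain ⟨t, ht, hpos⟩ := exists_pos_of_sum_zero_of_exists_nonzero
      (fun t => -((b Γ 0 ^ 2 - t ^ 2) * (t ^ 2 - b Γ 2) * r t))
      (by rw [sum_neg_distrib, hsum, neg_zero]) (by simpa only [neg_ne_zero] using hne)
    refine ⟨t, ht, lt_of_not_ge fun hge => hpos.not_ge (neg_nonpos.2 ?_)⟩
    exact mul_nonneg (mul_nonneg (sub_nonneg.2 (hle t ht)) (sub_nonneg.2 hge)) (hr0 t ht).le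
  · obtain ⟨t, ht, hpos⟩ := exists_pos_of_sum_zero_of_exists_nonzero _ hsum hne
    have h := pos_of_mul_pos_left hpos (hr0 t ht).le
    have hlt : 0 < b Γ 0 ^ 2 - t ^ 2 :=
      (sub_nonneg.2 (hle t ht)).lt_of_ne' (left_ne_zero_of_mul h.ne')
    exact ⟨t, ht, sub_pos.1 (pos_of_mul_pos_right h hlt.le), sub_pos.1 hlt⟩

theorem b_two_lt_eigenvalue_one_sq (hD : 4 ≤ Γ.diam) : b Γ 2 < eigenvalue Γ 1 ^ 2 := by
  obtain ⟨t, ht, hlt, hlt_k⟩ := (hΓ.exists_sq_lt_b_two_and_exists_b_two_lt_sq hb hD).2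
  obtain ⟨j, hj, hjt⟩ := hΓ.exists_eigenvalue_sq_eq hb ht
  refine hlt.trans_le (hjt ▸ ?_)
  rcases lt_trichotomy j 1 with h | rfl | h
  · rw [← hΓ.eigenvalue_zero hb, ← hjt, Nat.lt_one_iff.1 h] at hlt_k
    exact absurd hlt_k (lt_irrefl _)
  · exact le_rfl
  · exact (hΓ.eigenvalue_sq_lt hb h hj).le

theorem eigenvalue_half_diam_sq_lt_b_two (hD : 4 ≤ Γ.diam) :
    eigenvalue Γ (Γ.diam / 2) ^ 2 < b Γ 2 := by
  obtain ⟨t, ht, hlt⟩ := (hΓ.exists_sq_lt_b_two_and_exists_b_two_lt_sq hb hD).1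
  obtain ⟨j, hj, hjt⟩ := hΓ.exists_eigenvalue_sq_eq hb ht
  refine lt_of_le_of_lt (hjt ▸ ?_) hlt
  rcases (show j ≤ Γ.diam / 2 by omega).eq_or_lt with rfl | h
  · exact le_rfl
  · exact (hΓ.eigenvalue_sq_lt hb h (by omega)).le

end IsDistanceRegular

end EigenvalueBounds

section SupportedVectors

variable {X : Type*} {Γ : SimpleGraph X} {x : X}

/-- The vector `w` is supported on the sphere of radius `m` about `x`; equivalently `E*_m w = w`. -/
def SupportedAt (Γ : SimpleGraph X) (x : X) (m : ℕ) (w : X → ℂ) : Prop :=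
  ∀ z, Γ.dist x z ≠ m → w z = 0

theorem linearIndependent_of_supportedAt {ι : Type*} {m : ι → ℕ} (hm : Function.Injective m)
    {u : ι → X → ℂ} (hu : ∀ i, SupportedAt Γ x (m i) (u i)) (h0 : ∀ i, u i ≠ 0) :
    LinearIndependent ℂ u := by
  refine linearIndependent_iff'.2 fun s a ha i hi => ?_
  obtain ⟨z, hz⟩ := Function.ne_iff.1 (h0 i)
  have hdist : Γ.dist x z = m i := not_imp_comm.1 (hu i z) hz
  have h := congrFun ha z
  rw [Finset.sum_apply, sum_eq_single_of_mem i hi fun j _ hji => ?_] at h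
  · exact (mul_eq_zero.1 h).resolve_right hz
  · rw [Pi.smul_apply, hu j z (hdist ▸ hm.ne hji.symm), smul_zero]

variable [Fintype X]

theorem SupportedAt.adj_mulVec_apply_eq_zero (hc : Γ.Connected) (hb : Γ.IsBipartite) {m : ℕ}
    {w : X → ℂ} (hw : SupportedAt Γ x m w) {z : X} (h₁ : Γ.dist x z ≠ m + 1)
    (h₂ : Γ.dist x z + 1 ≠ m) : (distMatrix Γ 1 *ᵥ w) z = 0 := by
  rw [distMatrix_mulVec_apply]
  refine sum_eq_zero fun y hy => hw y fun hym => ?_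
  have h := dist_eq_or_eq_of_dist_eq_one hc hb x (mem_filter.1 hy).2
  rw [SimpleGraph.dist_comm (v := x), SimpleGraph.dist_comm (v := x)] at h
  omega

variable [DecidableEq X]

theorem dualIdem_mulVec_apply (i : ℕ) (w : X → ℂ) (z : X) :
    (dualIdem Γ x i *ᵥ w) z = if Γ.dist x z = i then w z else 0 := by
  rw [dualIdem, mulVec_diagonal, ite_mul, one_mul, zero_mul]

theorem supportedAt_dualIdem_mulVec (i : ℕ) (w : X → ℂ) :
    SupportedAt Γ x i (dualIdem Γ x i *ᵥ w) :=
  fun z hz => by rw [dualIdem_mulVec_apply, if_neg hz]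

namespace SupportedAt

variable {m : ℕ} {w : X → ℂ} (hw : SupportedAt Γ x m w)

include hw

theorem dualIdem_mulVec_self : dualIdem Γ x m *ᵥ w = w := by
  ext z
  rw [dualIdem_mulVec_apply]
  exact ite_eq_left_iff.2 fun hz => (hw z hz).symm

theorem dualIdem_mulVec_of_ne {j : ℕ} (hj : j ≠ m) : dualIdem Γ x j *ᵥ w = 0 := by
  ext z
  rw [dualIdem_mulVec_apply]
  exact ite_eq_right_iff.2 fun hz => hw z (hz ▸ hj)

theorem dualIdem_mulVec_adj_mulVec_of_ne (hc : Γ.Connected) (hb : Γ.IsBipartite) {j : ℕ}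
    (h₁ : j ≠ m + 1) (h₂ : j + 1 ≠ m) : dualIdem Γ x j *ᵥ (distMatrix Γ 1 *ᵥ w) = 0 := by
  ext z
  rw [dualIdem_mulVec_apply]
  exact ite_eq_right_iff.2 fun hz => hw.adj_mulVec_apply_eq_zero hc hb (hz ▸ h₁) (hz ▸ h₂)

end SupportedAt

theorem SupportedAt.adj_mulVec_eq (hc : Γ.Connected) (hb : Γ.IsBipartite) {m : ℕ} {w : X → ℂ}
    (hw : SupportedAt Γ x (m + 1) w) :
    distMatrix Γ 1 *ᵥ w = dualIdem Γ x (m + 2) *ᵥ (distMatrix Γ 1 *ᵥ w) +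
      dualIdem Γ x m *ᵥ (distMatrix Γ 1 *ᵥ w) := by
  ext z
  rw [Pi.add_apply, dualIdem_mulVec_apply, dualIdem_mulVec_apply]
  obtain h | h | ⟨h₁, h₂⟩ : Γ.dist x z = m + 2 ∨ Γ.dist x z = m ∨
      (Γ.dist x z ≠ m + 2 ∧ Γ.dist x z ≠ m) := by omega
  · simp [h]
  · simp [h]
  · rw [hw.adj_mulVec_apply_eq_zero hc hb h₁ (by omega), if_neg h₁, if_neg h₂, add_zero]

end SupportedVectors

section EndpointTwoVectors

variable {X : Type*} [Fintype X] {Γ : SimpleGraph X} {x : X} {v : X → ℂ}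

/-- The vectors supported on the sphere of radius `2` about `x` that satisfy `E*_1 A v = 0`. Every
vector of `E*_2 W` is one, where `W` is a `T`-module with endpoint `2`. -/
structure IsEndpointTwoVector (Γ : SimpleGraph X) (x : X) (v : X → ℂ) : Prop where
  supportedAt : SupportedAt Γ x 2 v
  adj_mulVec_apply : ∀ z, Γ.dist x z = 1 → (distMatrix Γ 1 *ᵥ v) z = 0

namespace IsEndpointTwoVector

variable (hv : IsEndpointTwoVector Γ x v)

include hv

theorem dist_cases (hc : Γ.Connected) (hb : Γ.IsBipartite) {i : ℕ} {y z : X} (hy : v y ≠ 0)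
    (hz : Γ.dist x z = i + 2) :
    Γ.dist z y = i ∨ Γ.dist z y = i + 2 ∨ Γ.dist z y = i + 4 := by
  have hxy : Γ.dist x y = 2 := not_imp_comm.1 (hv.supportedAt y) hy
  have h₁ := hc.dist_triangle (u := x) (v := y) (w := z)
  have h₂ := hc.dist_triangle (u := z) (v := x) (w := y)
  obtain ⟨r, hr⟩ := even_dist_add_dist_add_dist hc hb x z y
  rw [SimpleGraph.dist_comm (u := y)] at h₁ hr
  rw [SimpleGraph.dist_comm (u := z) (v := x)] at h₂
  omega

theorem sum_dist_mul (hc : Γ.Connected) (hb : Γ.IsBipartite) (F : ℕ → ℂ) {i : ℕ} {z : X}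
    (hz : Γ.dist x z = i + 2) :
    ∑ y, F (Γ.dist z y) * v y = F i * (distMatrix Γ i *ᵥ v) z +
      F (i + 2) * (distMatrix Γ (i + 2) *ᵥ v) z + F (i + 4) * (distMatrix Γ (i + 4) *ᵥ v) z := by
  simp only [distMatrix_mulVec_apply, sum_filter, mul_sum, ← sum_add_distrib]
  refine sum_congr rfl fun y _ => ?_
  by_cases hy : v y = 0
  · simp [hy]
  · rcases hv.dist_cases hc hb hy hz with h | h | h <;> simp [h]

theorem distMatrix_mulVec_apply_eq_zero (hc : Γ.Connected) (hb : Γ.IsBipartite) {i j : ℕ} {z : X}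
    (hz : Γ.dist x z = i + 2) (h₀ : j ≠ i) (h₂ : j ≠ i + 2) (h₄ : j ≠ i + 4) :
    (distMatrix Γ j *ᵥ v) z = 0 := by
  rw [distMatrix_mulVec_apply]
  refine sum_eq_zero fun y hy => by_contra fun hvy => ?_
  have hzy := (mem_filter.1 hy).2
  have h := hv.dist_cases hc hb hvy hz
  omega

-- Evaluate `A² v = k v + c₂ A₂ v` at `x`.
theorem sum_eq_zero (hΓ : IsDistanceRegular Γ) (hb : Γ.IsBipartite) (hD : 2 ≤ Γ.diam) :
    ∑ y, v y = 0 := by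
  classical
  have hA := congrFun (congrArg (· *ᵥ v) (hΓ.adj_mul_adj hb)) x
  have hx : v x = 0 := hv.supportedAt x (by simp)
  have hsum : (distMatrix Γ 2 *ᵥ v) x = ∑ y, v y := by
    rw [distMatrix_mulVec_apply]
    exact sum_filter_of_ne fun y _ => not_imp_comm.1 (hv.supportedAt y)
  have hzero : (distMatrix Γ 1 *ᵥ (distMatrix Γ 1 *ᵥ v)) x = 0 := by
    rw [distMatrix_mulVec_apply]
    exact Finset.sum_eq_zero fun z hz => hv.adj_mulVec_apply z (mem_filter.1 hz).2
  simp only [← mulVec_mulVec, hzero, add_mulVec, smul_mulVec, one_mulVec, Pi.add_apply,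
    Pi.smul_apply, hx, hsum, smul_zero, zero_add] at hA
  exact (smul_eq_zero.1 hA.symm).resolve_left (hΓ.c_pos (by omega) hD).ne'

theorem distMatrix_mulVec_apply_eq_zero_of_dist_lt (hΓ : IsDistanceRegular Γ)
    (hb : Γ.IsBipartite) (hD : 2 ≤ Γ.diam) (i : ℕ) {z : X} (hz : Γ.dist x z < 2) :
    (distMatrix Γ i *ᵥ v) z = 0 := by
  have hxy : ∀ y, v y ≠ 0 → Γ.dist x y = 2 := fun y => not_imp_comm.1 (hv.supportedAt y)
  have hsum := hv.sum_eq_zero hΓ hb hD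
  obtain h₀ | h₁ : Γ.dist x z = 0 ∨ Γ.dist x z = 1 := by omega
  · obtain rfl := hΓ.1.dist_eq_zero_iff.1 h₀
    rw [distMatrix_mulVec_apply]
    by_cases hi : i = 2
    · rw [hi, sum_filter_of_ne fun y _ => hxy y, hsum]
    · exact Finset.sum_eq_zero fun y hy => hv.supportedAt y ((mem_filter.1 hy).2 ▸ hi)
  · have hzy : ∀ y, v y ≠ 0 → Γ.dist z y = 1 ∨ Γ.dist z y = 3 := fun y hy => by
      have := dist_eq_or_eq_of_dist_eq_one hΓ.1 hb y h₁
      have := hxy y hy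
      omega
    have hadd : (distMatrix Γ 1 *ᵥ v) z + (distMatrix Γ 3 *ᵥ v) z = 0 := by
      rw [← hsum]
      simp only [distMatrix_mulVec_apply, sum_filter, ← sum_add_distrib]
      refine sum_congr rfl fun y _ => ?_
      by_cases hy : v y = 0
      · simp [hy]
      · rcases hzy y hy with h | h <;> simp [h]
    rw [hv.adj_mulVec_apply z h₁, zero_add] at hadd
    by_cases hi : i = 1 ∨ i = 3
    · rcases hi with rfl | rfl
      exacts [hv.adj_mulVec_apply z h₁, hadd]
    · rw [distMatrix_mulVec_apply]
      refine Finset.sum_eq_zero fun y hy => by_contra fun hvy => hi ?_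
      exact (mem_filter.1 hy).2 ▸ hzy y hvy

theorem distMatrix_mulVec_apply_add_add (hΓ : IsDistanceRegular Γ) (hb : Γ.IsBipartite)
    (hD : 2 ≤ Γ.diam) {i : ℕ} {z : X} (hz : Γ.dist x z = i + 2) :
    (distMatrix Γ i *ᵥ v) z + (distMatrix Γ (i + 2) *ᵥ v) z + (distMatrix Γ (i + 4) *ᵥ v) z =
      0 := by
  have h := hv.sum_dist_mul hΓ.1 hb (fun _ => 1) hz
  simpa only [one_mul, hv.sum_eq_zero hΓ hb hD] using h.symm

end IsEndpointTwoVector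

variable [DecidableEq X]

/-- The vector `E*_{i+2} A_i v`; for `i + 4 ≤ D` these form one of the two bases of `W`. -/
noncomputable def up (Γ : SimpleGraph X) (x : X) (v : X → ℂ) (i : ℕ) : X → ℂ :=
  (dualIdem Γ x (i + 2) * distMatrix Γ i) *ᵥ v

/-- The vector `E*_i A_{i+2} v`; when `W` is thin, `lo Γ x v (i + 2)` is a multiple of
`up Γ x v i`. -/
noncomputable def lo (Γ : SimpleGraph X) (x : X) (v : X → ℂ) (i : ℕ) : X → ℂ :=
  (dualIdem Γ x i * distMatrix Γ (i + 2)) *ᵥ v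

theorem up_apply (i : ℕ) (z : X) :
    up Γ x v i z = if Γ.dist x z = i + 2 then (distMatrix Γ i *ᵥ v) z else 0 := by
  rw [up, ← mulVec_mulVec, dualIdem_mulVec_apply]

theorem lo_apply (i : ℕ) (z : X) :
    lo Γ x v i z = if Γ.dist x z = i then (distMatrix Γ (i + 2) *ᵥ v) z else 0 := by
  rw [lo, ← mulVec_mulVec, dualIdem_mulVec_apply]

theorem supportedAt_up (v : X → ℂ) (i : ℕ) : SupportedAt Γ x (i + 2) (up Γ x v i) :=
  fun z hz => by rw [up_apply, if_neg hz]

theorem supportedAt_lo (v : X → ℂ) (i : ℕ) : SupportedAt Γ x i (lo Γ x v i) :=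
  fun z hz => by rw [lo_apply, if_neg hz]

namespace IsEndpointTwoVector

variable (hv : IsEndpointTwoVector Γ x v) (hΓ : IsDistanceRegular Γ)

include hv hΓ

theorem up_zero : up Γ x v 0 = v := by
  rw [up, hΓ.distMatrix_zero, mul_one, hv.supportedAt.dualIdem_mulVec_self]

variable (hb : Γ.IsBipartite)

include hb

theorem up_one : up Γ x v 1 = distMatrix Γ 1 *ᵥ v := by
  ext z
  rw [up_apply]
  refine ite_eq_left_iff.2 fun hz => ?_
  by_cases h₁ : Γ.dist x z = 1
  · exact (hv.adj_mulVec_apply z h₁).symm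
  · exact (hv.supportedAt.adj_mulVec_apply_eq_zero hΓ.1 hb hz (by omega)).symm

variable (hD : 2 ≤ Γ.diam)

include hD

theorem lo_of_lt {i : ℕ} (hi : i < 2) : lo Γ x v i = 0 := by
  ext z
  rw [lo_apply]
  exact ite_eq_right_iff.2 fun hz =>
    hv.distMatrix_mulVec_apply_eq_zero_of_dist_lt hΓ hb hD _ (hz ▸ hi)

theorem distMatrix_add_two_mulVec (i : ℕ) :
    distMatrix Γ (i + 2) *ᵥ v =
      lo Γ x v i - up Γ x v i - lo Γ x v (i + 2) + up Γ x v (i + 2) := by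
  ext z
  simp only [Pi.add_apply, Pi.sub_apply, up_apply, lo_apply]
  obtain h | h | h | ⟨h₀, h₂, h₄⟩ : Γ.dist x z = i ∨ Γ.dist x z = i + 2 ∨ Γ.dist x z = i + 4 ∨
    (Γ.dist x z ≠ i ∧ Γ.dist x z ≠ i + 2 ∧ Γ.dist x z ≠ i + 4) := by omega
  · simp [h, show i ≠ i + 2 + 2 by omega]
  · have hsum := hv.distMatrix_mulVec_apply_add_add hΓ hb hD h
    simp only [h, if_true, Nat.add_eq_left, OfNat.ofNat_ne_zero,
      Nat.left_eq_add, if_false]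
    linear_combination hsum
  · simp [h]
  · have hzero : (distMatrix Γ (i + 2) *ᵥ v) z = 0 := by
      rcases lt_or_ge (Γ.dist x z) 2 with hlt | hge
      · exact hv.distMatrix_mulVec_apply_eq_zero_of_dist_lt hΓ hb hD _ hlt
      · obtain ⟨m, hm⟩ := Nat.exists_eq_add_of_le' hge
        exact hv.distMatrix_mulVec_apply_eq_zero hΓ.1 hb hm (by omega) (by omega) (by omega)
    simp [h₀, h₂, h₄, hzero]

theorem aeval_p_mulVec {i : ℕ} (hi : i ≤ Γ.diam) :
    aeval (distMatrix Γ 1) (p Γ i) *ᵥ v = up Γ x v i - lo Γ x v i := by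
  induction i using Nat.twoStepInduction with
  | zero =>
    rw [p_zero, map_one, one_mulVec, hv.lo_of_lt hΓ hb hD two_pos, hv.up_zero hΓ, sub_zero]
  | one =>
    rw [p_one, hΓ.f_one hi, aeval_X, hv.lo_of_lt hΓ hb hD one_lt_two, sub_zero,
      hv.up_one hΓ hb]
  | more i ih _ =>
    rw [p_add_two, map_add, add_mulVec, ih (by omega), hΓ.aeval_f hb hi,
      hv.distMatrix_add_two_mulVec hΓ hb hD]
    abel

theorem adj_mulVec_up_sub_lo {i : ℕ} (hi : i + 2 ≤ Γ.diam) :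
    distMatrix Γ 1 *ᵥ up Γ x v (i + 1) - distMatrix Γ 1 *ᵥ lo Γ x v (i + 1) =
      c Γ (i + 2) • (up Γ x v (i + 2) - lo Γ x v (i + 2)) +
        b Γ (i + 2) • (up Γ x v i - lo Γ x v i) := by
  have h := congrArg (fun q => aeval (distMatrix Γ 1) q *ᵥ v) (hΓ.X_mul_p hb hi)
  simp only [map_mul, map_add, aeval_X, aeval_C, ← Algebra.smul_def, add_mulVec, smul_mulVec,
    ← mulVec_mulVec] at h
  rwa [hv.aeval_p_mulVec hΓ hb hD (by omega), hv.aeval_p_mulVec hΓ hb hD hi,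
    hv.aeval_p_mulVec hΓ hb hD (by omega), mulVec_sub] at h

theorem dualIdem_mulVec_adj_mulVec_up_above {i : ℕ} (hi : i + 1 ≤ Γ.diam) :
    dualIdem Γ x (i + 3) *ᵥ (distMatrix Γ 1 *ᵥ up Γ x v i) = c Γ (i + 1) • up Γ x v (i + 1) := by
  rcases i with _ | i
  · rw [hv.up_zero hΓ, hΓ.c_one hi, one_smul, up, ← mulVec_mulVec]
  · have h := congrArg (dualIdem Γ x (i + 4) *ᵥ ·) (hv.adj_mulVec_up_sub_lo hΓ hb hD hi)
    simp only [mulVec_sub, mulVec_add, mulVec_smul] at h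
    rw [(supportedAt_lo v (i + 1)).dualIdem_mulVec_adj_mulVec_of_ne hΓ.1 hb (by omega) (by omega),
      (supportedAt_up v (i + 2)).dualIdem_mulVec_self,
      (supportedAt_lo v (i + 2)).dualIdem_mulVec_of_ne (by omega),
      (supportedAt_lo v i).dualIdem_mulVec_of_ne (by omega),
      (supportedAt_up v i).dualIdem_mulVec_of_ne (by omega)] at h
    simpa only [sub_zero, sub_self, smul_zero, add_zero] using h

theorem dualIdem_mulVec_adj_mulVec_lo_below {i : ℕ} (hi : i + 2 ≤ Γ.diam) :
    dualIdem Γ x i *ᵥ (distMatrix Γ 1 *ᵥ lo Γ x v (i + 1)) = b Γ (i + 2) • lo Γ x v i := by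
  have h := congrArg (dualIdem Γ x i *ᵥ ·) (hv.adj_mulVec_up_sub_lo hΓ hb hD hi)
  simp only [mulVec_sub, mulVec_add, mulVec_smul] at h
  rw [(supportedAt_up v (i + 1)).dualIdem_mulVec_adj_mulVec_of_ne hΓ.1 hb (by omega) (by omega),
    (supportedAt_up v (i + 2)).dualIdem_mulVec_of_ne (by omega),
    (supportedAt_lo v (i + 2)).dualIdem_mulVec_of_ne (by omega),
    (supportedAt_lo v i).dualIdem_mulVec_self,
    (supportedAt_up v i).dualIdem_mulVec_of_ne (by omega)] at h
  simpa only [zero_sub, sub_self, smul_zero, smul_neg, zero_add, neg_inj] using h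

theorem dualIdem_mulVec_adj_mulVec_up_below {i : ℕ} (hi : i + 2 ≤ Γ.diam) :
    dualIdem Γ x (i + 2) *ᵥ (distMatrix Γ 1 *ᵥ up Γ x v (i + 1)) =
      dualIdem Γ x (i + 2) *ᵥ (distMatrix Γ 1 *ᵥ lo Γ x v (i + 1)) +
        b Γ (i + 2) • up Γ x v i - c Γ (i + 2) • lo Γ x v (i + 2) := by
  have h := congrArg (dualIdem Γ x (i + 2) *ᵥ ·) (hv.adj_mulVec_up_sub_lo hΓ hb hD hi)
  simp only [mulVec_sub, mulVec_add, mulVec_smul] at h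
  rw [(supportedAt_up v (i + 2)).dualIdem_mulVec_of_ne (by omega),
    (supportedAt_lo v (i + 2)).dualIdem_mulVec_self,
    (supportedAt_lo v i).dualIdem_mulVec_of_ne (by omega),
    (supportedAt_up v i).dualIdem_mulVec_self, sub_eq_iff_eq_add] at h
  rw [h, zero_sub, sub_zero, smul_neg]
  abel

end IsEndpointTwoVector

end EndpointTwoVectors

section TModules

variable {X : Type*} [Fintype X] [DecidableEq X] {Γ : SimpleGraph X} {x : X}
  {W : Submodule ℂ (X → ℂ)}

theorem isTModule_iff : IsTModule Γ x W ↔ (∀ w ∈ W, distMatrix Γ 1 *ᵥ w ∈ W) ∧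
    ∀ i, ∀ w ∈ W, dualIdem Γ x i *ᵥ w ∈ W := by
  refine ⟨fun h => ⟨h _ ((le_sup_left : boseMesner Γ ≤ _) (Algebra.subset_adjoin rfl)),
    fun i => h _ ((le_sup_right : dualBoseMesner Γ x ≤ _) (Algebra.subset_adjoin ⟨i, rfl⟩))⟩,
    fun ⟨hA, hE⟩ => ?_⟩
  let S : Subalgebra ℂ (Matrix X X ℂ) :=
    { carrier := {B | ∀ w ∈ W, B *ᵥ w ∈ W}
      mul_mem' := fun hB hC w hw => by
        rw [← mulVec_mulVec]
        exact hB _ (hC _ hw)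
      add_mem' := fun hB hC w hw => by
        rw [add_mulVec]
        exact W.add_mem (hB _ hw) (hC _ hw)
      algebraMap_mem' := fun r w hw => by
        rw [Algebra.algebraMap_eq_smul_one, smul_mulVec, one_mulVec]
        exact W.smul_mem r hw }
  have hS : subconstituentAlgebra Γ x ≤ S :=
    sup_le (Algebra.adjoin_le (Set.singleton_subset_iff.2 hA))
      (Algebra.adjoin_le (Set.range_subset_iff.2 hE))
  exact fun B hB => hS hB

theorem aeval_mulVec_mem (hA : ∀ w ∈ W, distMatrix Γ 1 *ᵥ w ∈ W) (q : ℝ[X]) {w : X → ℂ}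
    (hw : w ∈ W) : aeval (distMatrix Γ 1) q *ᵥ w ∈ W := by
  induction q using Polynomial.induction_on with
  | C a =>
    rw [aeval_C, Algebra.algebraMap_eq_smul_one, smul_mulVec, one_mulVec]
    exact W.smul_mem (a : ℂ) hw
  | add q r hq hr =>
    rw [map_add, add_mulVec]
    exact W.add_mem hq hr
  | monomial n a ih =>
    rw [pow_succ', mul_left_comm, map_mul, aeval_X, ← mulVec_mulVec]
    exact hA _ ih

namespace IsTModule

variable (hW : IsTModule Γ x W)

include hW

theorem adj_mulVec_mem {w : X → ℂ} (hw : w ∈ W) : distMatrix Γ 1 *ᵥ w ∈ W :=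
  (isTModule_iff.1 hW).1 w hw

theorem dualIdem_mulVec_mem (i : ℕ) {w : X → ℂ} (hw : w ∈ W) : dualIdem Γ x i *ᵥ w ∈ W :=
  (isTModule_iff.1 hW).2 i w hw

theorem distMatrix_mulVec_mem (hΓ : IsDistanceRegular Γ) (hb : Γ.IsBipartite) (i : ℕ)
    {w : X → ℂ} (hw : w ∈ W) : distMatrix Γ i *ᵥ w ∈ W := by
  rcases le_or_gt i Γ.diam with hi | hi
  · rw [← hΓ.aeval_f hb hi]
    exact aeval_mulVec_mem (fun _ => hW.adj_mulVec_mem) _ hw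
  · rw [hΓ.distMatrix_eq_zero hi, zero_mulVec]
    exact W.zero_mem

theorem up_mem (hΓ : IsDistanceRegular Γ) (hb : Γ.IsBipartite) (i : ℕ) {v : X → ℂ}
    (hv : v ∈ W) : up Γ x v i ∈ W := by
  rw [up, ← mulVec_mulVec]
  exact hW.dualIdem_mulVec_mem _ (hW.distMatrix_mulVec_mem hΓ hb i hv)

theorem lo_mem (hΓ : IsDistanceRegular Γ) (hb : Γ.IsBipartite) (i : ℕ) {v : X → ℂ}
    (hv : v ∈ W) : lo Γ x v i ∈ W := by
  rw [lo, ← mulVec_mulVec]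
  exact hW.dualIdem_mulVec_mem _ (hW.distMatrix_mulVec_mem hΓ hb _ hv)

theorem mem_of_mem_dualPart {i : ℕ} {w : X → ℂ} (hw : w ∈ dualPart Γ x i W) : w ∈ W := by
  obtain ⟨u, hu, rfl⟩ := hw
  exact hW.dualIdem_mulVec_mem i hu

end IsTModule

theorem SupportedAt.mem_dualPart {m : ℕ} {w : X → ℂ} (hw : SupportedAt Γ x m w) (hwW : w ∈ W) :
    w ∈ dualPart Γ x m W :=
  ⟨w, hwW, hw.dualIdem_mulVec_self⟩

theorem supportedAt_of_mem_dualPart {m : ℕ} {w : X → ℂ} (hw : w ∈ dualPart Γ x m W) :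
    SupportedAt Γ x m w := by
  obtain ⟨u, -, rfl⟩ := hw
  exact supportedAt_dualIdem_mulVec m u

theorem IsThin.exists_eq_smul (hthin : IsThin Γ x W) {m : ℕ} (hm : m ≤ Γ.diam) {u w : X → ℂ}
    (hu : u ∈ W) (hw : w ∈ W) (hus : SupportedAt Γ x m u) (hws : SupportedAt Γ x m w)
    (hu0 : u ≠ 0) : ∃ ρ : ℂ, w = ρ • u := by
  obtain ⟨y, hy⟩ := finrank_le_one_iff.1 (hthin m hm)
  obtain ⟨a, ha⟩ := hy ⟨u, hus.mem_dualPart hu⟩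
  obtain ⟨e, he⟩ := hy ⟨w, hws.mem_dualPart hw⟩
  replace ha : a • (y : X → ℂ) = u := congrArg Subtype.val ha
  replace he : e • (y : X → ℂ) = w := congrArg Subtype.val he
  have ha0 : a ≠ 0 := fun h => hu0 (by rw [← ha, h, zero_smul])
  exact ⟨e / a, by rw [← ha, ← he, smul_smul, div_mul_cancel₀ _ ha0]⟩

theorem apply_eq_zero_of_dist_lt_endpoint (hc : Γ.Connected) {w : X → ℂ} (hw : w ∈ W) {z : X}
    (hz : Γ.dist x z < endpoint Γ x W) : w z = 0 := by
  have hbot : dualPart Γ x (Γ.dist x z) W = ⊥ := by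
    by_contra hne
    exact (Nat.sInf_le ⟨dist_le_diam_of_connected hc x z, hne⟩ : endpoint Γ x W ≤ _).not_gt hz
  have hmem : dualIdem Γ x (Γ.dist x z) *ᵥ w ∈ dualPart Γ x (Γ.dist x z) W := ⟨w, hw, rfl⟩
  rw [hbot, Submodule.mem_bot] at hmem
  have hzero := congrFun hmem z
  rwa [dualIdem_mulVec_apply, if_pos rfl] at hzero

theorem IsTModule.isEndpointTwoVector (hW : IsTModule Γ x W) (hc : Γ.Connected)
    (hend : endpoint Γ x W = 2) {v : X → ℂ} (hv : v ∈ dualPart Γ x 2 W) :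
    IsEndpointTwoVector Γ x v where
  supportedAt := supportedAt_of_mem_dualPart hv
  adj_mulVec_apply _ hz := apply_eq_zero_of_dist_lt_endpoint hc
    (hW.adj_mulVec_mem (hW.mem_of_mem_dualPart hv))
    (by rw [hz, hend]; exact one_lt_two)

theorem HasLocalEigenvalue.distMatrix_two_mulVec_apply {η : ℝ} (h : HasLocalEigenvalue Γ x W η)
    {v : X → ℂ} (hv : v ∈ dualPart Γ x 2 W) {z : X} (hz : Γ.dist x z = 2) :
    (distMatrix Γ 2 *ᵥ v) z = η * v z := by
  have h₂ := congrFun (h.2 v hv) z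
  rwa [← mulVec_mulVec, (supportedAt_of_mem_dualPart hv).dualIdem_mulVec_self, ← mulVec_mulVec,
    dualIdem_mulVec_apply, if_pos hz] at h₂

end TModules

section UpBasis

variable {X : Type*} [Fintype X] [DecidableEq X] {Γ : SimpleGraph X} {x : X}
  {W : Submodule ℂ (X → ℂ)} {v : X → ℂ}

theorem up_eq_zero_of_diam_lt (hc : Γ.Connected) (v : X → ℂ) {i : ℕ} (hi : Γ.diam < i + 2) :
    up Γ x v i = 0 :=
  funext fun z => supportedAt_up v i z ((dist_le_diam_of_connected hc x z).trans_lt hi).ne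

theorem linearIndependent_up {P : ℕ → Prop} (hP : ∀ i, P i → up Γ x v i ≠ 0) :
    LinearIndependent ℂ fun i : {i // P i} => up Γ x v i :=
  linearIndependent_of_supportedAt (m := fun i : {i // P i} => (i : ℕ) + 2)
    ((add_left_injective 2).comp Subtype.val_injective) (fun i => supportedAt_up v i)
    fun i => hP i i.2

namespace IsEndpointTwoVector

variable (hv : IsEndpointTwoVector Γ x v) (hΓ : IsDistanceRegular Γ) (hb : Γ.IsBipartite)
  (hD : 2 ≤ Γ.diam)

include hv hΓ hb hD

theorem up_succ_eq_zero {i : ℕ} (hi : up Γ x v i = 0) : up Γ x v (i + 1) = 0 := by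
  rcases le_or_gt (i + 1) Γ.diam with h | h
  · have hup := hv.dualIdem_mulVec_adj_mulVec_up_above hΓ hb hD h
    rw [hi, mulVec_zero, mulVec_zero] at hup
    exact (smul_eq_zero.1 hup.symm).resolve_left (hΓ.c_pos (by omega) h).ne'
  · exact up_eq_zero_of_diam_lt hΓ.1 v (by omega)

theorem exists_up_ne_zero_iff : ∃ N, ∀ i, up Γ x v i ≠ 0 ↔ i < N := by
  classical
  have hex : ∃ i, up Γ x v i = 0 := ⟨Γ.diam, up_eq_zero_of_diam_lt hΓ.1 v (by omega)⟩
  refine ⟨Nat.find hex, fun i => ⟨fun hi => ?_, Nat.find_min hex⟩⟩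
  by_contra! hle
  exact hi (Nat.le_induction (Nat.find_spec hex)
    (fun j _ => hv.up_succ_eq_zero hΓ hb hD) i hle)

variable (hthin : IsThin Γ x W) (hvW : v ∈ W)

include hthin hvW

theorem exists_adj_mulVec_up (hW : IsTModule Γ x W) (i : ℕ) :
    ∃ ρ : ℂ, distMatrix Γ 1 *ᵥ up Γ x v i =
      c Γ (i + 1) • up Γ x v (i + 1) + ρ • up Γ x v (i - 1) := by
  rcases i with _ | i
  · exact ⟨0, by rw [hv.up_zero hΓ, hv.up_one hΓ hb, hΓ.c_one (by omega), one_smul, zero_smul,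
      add_zero]⟩
  by_cases h₀ : up Γ x v i = 0
  · have h₁ := hv.up_succ_eq_zero hΓ hb hD h₀
    exact ⟨0, by rw [h₁, hv.up_succ_eq_zero hΓ hb hD h₁, mulVec_zero, smul_zero, zero_smul,
      add_zero]⟩
  have hi : i + 2 ≤ Γ.diam := not_lt.1 (mt (up_eq_zero_of_diam_lt hΓ.1 v) h₀)
  obtain ⟨ρ, hρ⟩ := hthin.exists_eq_smul hi (hW.up_mem hΓ hb i hvW)
    (hW.dualIdem_mulVec_mem (i + 2) (hW.adj_mulVec_mem (hW.up_mem hΓ hb (i + 1) hvW)))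
    (supportedAt_up v i) (supportedAt_dualIdem_mulVec _ _) h₀
  refine ⟨ρ, ?_⟩
  rw [(supportedAt_up v (i + 1)).adj_mulVec_eq hΓ.1 hb, hρ,
    hv.dualIdem_mulVec_adj_mulVec_up_above hΓ hb hD hi, Nat.add_sub_cancel]

variable (hW : IsIrreducibleTModule Γ x W) (hv0 : v ≠ 0)

include hW hv0

theorem span_range_up : Submodule.span ℂ (Set.range (up Γ x v)) = W := by
  set S := Submodule.span ℂ (Set.range (up Γ x v))
  have hup : ∀ i, up Γ x v i ∈ S := fun i => Submodule.subset_span ⟨i, rfl⟩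
  have hmap : ∀ B : Matrix X X ℂ, (∀ i, B *ᵥ up Γ x v i ∈ S) → ∀ w ∈ S, B *ᵥ w ∈ S :=
    fun B hB => show S ≤ S.comap B.mulVecLin from Submodule.span_le.2 (Set.range_subset_iff.2 hB)
  have hT : IsTModule Γ x S := by
    refine isTModule_iff.2 ⟨hmap _ fun i => ?_, fun j => hmap _ fun i => ?_⟩
    · obtain ⟨ρ, hρ⟩ := hv.exists_adj_mulVec_up hΓ hb hD hthin hvW hW.1 i
      rw [hρ]
      exact S.add_mem (S.smul_mem (c Γ (i + 1) : ℂ) (hup _)) (S.smul_mem _ (hup _))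
    · by_cases hj : j = i + 2
      · rw [hj, (supportedAt_up v i).dualIdem_mulVec_self]
        exact hup i
      · rw [(supportedAt_up v i).dualIdem_mulVec_of_ne hj]
        exact S.zero_mem
  refine (hW.2.2 S hT (Submodule.span_le.2 (Set.range_subset_iff.2 fun i =>
    hW.1.up_mem hΓ hb i hvW))).resolve_left fun hbot => hv0 ?_
  rw [← Submodule.mem_bot ℂ, ← hbot, ← hv.up_zero hΓ]
  exact hup 0

theorem span_up {P : ℕ → Prop} (hP : ∀ i, ¬ P i → up Γ x v i = 0) :
    Submodule.span ℂ (Set.range fun i : {i // P i} => up Γ x v i) = W := by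
  refine (hv.span_range_up hΓ hb hD hthin hvW hW hv0).symm ▸ le_antisymm
    (Submodule.span_mono (Set.range_subset_iff.2 fun i => ⟨i, rfl⟩))
    (Submodule.span_le.2 (Set.range_subset_iff.2 fun i => ?_))
  by_cases hi : P i
  · exact Submodule.subset_span ⟨⟨i, hi⟩, rfl⟩
  · rw [hP i hi]
    exact Submodule.zero_mem _

theorem up_ne_zero_iff (i : ℕ) : up Γ x v i ≠ 0 ↔ i < Module.finrank ℂ W := by
  obtain ⟨N, hN⟩ := hv.exists_up_ne_zero_iff hΓ hb hD
  have hspan := hv.span_up hΓ hb hD hthin hvW hW hv0 (P := (· < N))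
    fun j => not_imp_comm.1 (hN j).1
  let _ : Fintype {i // i < N} := Fintype.ofEquiv _ Fin.equivSubtype
  have hcard := finrank_span_eq_card (linearIndependent_up fun j => (hN j).2)
  rw [hspan, Fintype.ofEquiv_card, Fintype.card_fin] at hcard
  rw [hcard, hN]

theorem le_of_adj_mulVec_mem {U : Submodule ℂ (X → ℂ)} (hU : ∀ w ∈ U, distMatrix Γ 1 *ᵥ w ∈ U)
    (hvU : v ∈ U) : W ≤ U := by
  rw [← hv.span_range_up hΓ hb hD hthin hvW hW hv0, Submodule.span_le]
  refine Set.range_subset_iff.2 fun i => ?_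
  induction i using Nat.strong_induction_on with
  | _ i ih =>
    rcases i with _ | i
    · rwa [hv.up_zero hΓ]
    rcases le_or_gt (i + 1) Γ.diam with hi | hi
    · obtain ⟨ρ, hρ⟩ := hv.exists_adj_mulVec_up hΓ hb hD hthin hvW hW.1 i
      have hc : (c Γ (i + 1) : ℂ) ≠ 0 := Complex.ofReal_ne_zero.2 (hΓ.c_pos (by omega) hi).ne'
      refine (U.smul_mem_iff hc).1 ?_
      rw [show (c Γ (i + 1) : ℂ) • up Γ x v (i + 1) = _ from eq_sub_of_add_eq hρ.symm]
      exact U.sub_mem (hU _ (ih i (by omega))) (U.smul_mem _ (ih (i - 1) (by omega)))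
    · rw [up_eq_zero_of_diam_lt hΓ.1 v (by omega)]
      exact U.zero_mem

end IsEndpointTwoVector

end UpBasis

section PrimitiveIdempotents

variable {X : Type*} [Fintype X] {Γ : SimpleGraph X}

theorem one_add_tilde_mul {θ : ℝ} (hθ : θ ^ 2 ≠ b Γ 2) :
    (1 + tilde Γ θ) * (θ ^ 2 - b Γ 2) = -(b Γ 2 * b Γ 3) := by
  rw [tilde, ← add_sub_assoc, add_neg_cancel, zero_sub, neg_mul,
    div_mul_cancel₀ _ (sub_ne_zero.2 hθ)]

theorem mem_indexSet_iff {D n j : ℕ} (hj : j ≤ D) :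
    j ∈ indexSet D n ↔ ¬((j = 0 ∨ j = D) ∨ j = n ∨ j = D - n) := by
  rw [indexSet, mem_filter, mem_Icc]
  omega

theorem card_indexSet {D n : ℕ} (hn : 1 ≤ n) (hnD : 2 * n < D) : #(indexSet D n) = D - 3 := by
  have h : indexSet D n = (Icc 1 (D - 1)) \ {n, D - n} := by
    ext j
    simp only [indexSet, mem_filter, mem_sdiff, mem_insert, mem_singleton, not_or]
  rw [h, card_sdiff_of_subset, Nat.card_Icc, card_pair (by omega)]
  · omega
  · intro j hj
    rw [mem_insert, mem_singleton] at hj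
    rw [mem_Icc]
    omega

namespace IsDistanceRegular

variable (hΓ : IsDistanceRegular Γ) (hb : Γ.IsBipartite)

include hΓ hb

-- For `F` the entries of `E_t` as a function of the distance, the last factor on the left is
-- `‖E_t v‖² / ‖v‖²` when `v` is an eigenvector of `E*_2 A_2 E*_2` for `η`.
theorem prod_b_mul_eq_of_recurrence (hD : 4 ≤ Γ.diam) {F : ℕ → ℝ} {t : ℝ}
    (hF : ∀ i ≤ Γ.diam, c Γ i * F (i - 1) + b Γ i * F (i + 1) = t * F i) (η : ℝ) :
    b Γ 0 * b Γ 1 * b Γ 2 * b Γ 3 * (F 0 + η * F 2 - (1 + η) * F 4) =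
      F 0 * ((b Γ 0 ^ 2 - t ^ 2) * (b Γ 2 * b Γ 3 + (1 + η) * (t ^ 2 - b Γ 2))) := by
  have r₀ : b Γ 0 * F 1 = t * F 0 := by
    simpa only [c_zero, zero_mul, zero_add] using hF 0 (Nat.zero_le _)
  have r₁ : F 0 + b Γ 1 * F 2 = t * F 1 := by
    simpa only [hΓ.c_one (by omega), one_mul] using hF 1 (by omega)
  have r₂ : c Γ 2 * F 1 + b Γ 2 * F 3 = t * F 2 := hF 2 (by omega)
  have r₃ : c Γ 3 * F 2 + b Γ 3 * F 4 = t * F 3 := hF 3 (by omega)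
  have hb₁ : b Γ 1 = b Γ 0 - 1 := by
    rw [← hΓ.b_add_c hb (i := 1) (by omega), hΓ.c_one (by omega), add_sub_cancel_right]
  have hc₂ : c Γ 2 = b Γ 0 - b Γ 2 := by linarith [hΓ.b_add_c hb (i := 2) (by omega)]
  have hc₃ : c Γ 3 = b Γ 0 - b Γ 3 := by linarith [hΓ.b_add_c hb (i := 3) (by omega)]
  rw [hc₂] at r₂
  rw [hc₃] at r₃
  rw [hb₁] at r₁ ⊢
  linear_combination (-(1 + η) * b Γ 0 * (b Γ 0 - 1) * b Γ 2) * r₃ -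
    ((1 + η) * b Γ 0 * (b Γ 0 - 1) * t) * r₂ +
    (η * b Γ 0 * b Γ 2 * b Γ 3 - (1 + η) * b Γ 0 * (t ^ 2 - b Γ 2 * (b Γ 0 - b Γ 3))) * r₁ +
    ((η * b Γ 2 * b Γ 3 - (1 + η) * (t ^ 2 - b Γ 2 * (b Γ 0 - b Γ 3))) * t +
      (1 + η) * (b Γ 0 - 1) * t * (b Γ 0 - b Γ 2)) * r₀

variable [DecidableEq X] {w : X → ℂ} {J : Finset ℕ}

theorem aeval_mulVec_eq_sum_primIdem_mulVec (hJ : ∀ j ∈ J, j ≤ Γ.diam)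
    (h₀ : ∀ j ≤ Γ.diam, j ∉ J → primIdem Γ j *ᵥ w = 0) (q : ℝ[X]) :
    aeval (distMatrix Γ 1) q *ᵥ w =
      ∑ j ∈ J, q.eval (eigenvalue Γ j) • primIdem Γ j *ᵥ w := by
  have hinj : Set.InjOn (eigenvalue Γ) (range (Γ.diam + 1)) :=
    (hΓ.strictAntiOn_eigenvalue hb).injOn.mono fun j hj => Nat.lt_succ_iff.1 (mem_range.1 hj)
  rw [aeval_eq_sum_eigenProj, ← hΓ.image_eigenvalue hb, sum_image hinj, sum_mulVec,
    ← sum_subset (s₁ := J) fun j hj => mem_range.2 (Nat.lt_succ_of_le (hJ j hj))]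
  · exact sum_congr rfl fun j _ => smul_mulVec _ _ _
  · intro j hj hjJ
    rw [smul_mulVec, ← primIdem_eq_eigenProj, h₀ j (Nat.lt_succ_iff.1 (mem_range.1 hj)) hjJ,
      smul_zero]

theorem linearIndependent_primIdem_mulVec (hJ : ∀ j ∈ J, j ≤ Γ.diam)
    (h₀ : ∀ j ∈ J, primIdem Γ j *ᵥ w ≠ 0) :
    LinearIndependent ℂ fun j : {j : ℕ // j ∈ J} => primIdem Γ j *ᵥ w := by
  have hinj : Function.Injective fun j : {j : ℕ // j ∈ J} => (eigenvalue Γ j : ℂ) := fun i j hij =>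
    Subtype.ext ((hΓ.strictAntiOn_eigenvalue hb).injOn (hJ i i.2) (hJ j j.2)
      (Complex.ofReal_injective hij))
  refine Module.End.eigenvectors_linearIndependent' (distMatrix Γ 1).mulVecLin _ hinj _
    fun j => ⟨Module.End.mem_eigenspace_iff.2 ?_, h₀ j j.2⟩
  rw [mulVecLin_apply, primIdem_eq_eigenProj, mulVec_mulVec, adj_mul_eigenProj, smul_mulVec]
  rfl

end IsDistanceRegular

namespace IsEndpointTwoVector

variable [DecidableEq X] {x : X} {v : X → ℂ} (hv : IsEndpointTwoVector Γ x v)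
  (hΓ : IsDistanceRegular Γ) (hb : Γ.IsBipartite)

include hv hΓ hb

section LocalEigenvalue

variable {η : ℝ} (hη : ∀ z, Γ.dist x z = 2 → (distMatrix Γ 2 *ᵥ v) z = η * v z)

include hη

theorem star_dotProduct_eigenProj_mulVec_eq (hD : 2 ≤ Γ.diam) {t : ℝ} {F : ℕ → ℝ}
    (hF : ∀ y z, eigenProj Γ t y z = F (Γ.dist y z)) :
    star v ⬝ᵥ (eigenProj Γ t *ᵥ v) =
      ((F 0 + η * F 2 - (1 + η) * F 4 : ℝ) : ℂ) * (star v ⬝ᵥ v) := by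
  rw [dotProduct, dotProduct, mul_sum]
  refine sum_congr rfl fun z _ => ?_
  by_cases hz : Γ.dist x z = 2
  · have hE : (eigenProj Γ t *ᵥ v) z = F 0 * v z + F 2 * (η * v z) +
        F 4 * (distMatrix Γ 4 *ᵥ v) z := by
      have h := hv.sum_dist_mul hΓ.1 hb (fun i => (F i : ℂ)) (i := 0) hz
      rw [hΓ.distMatrix_zero, one_mulVec, hη z hz] at h
      simpa only [mulVec, dotProduct, hF] using h
    have h₄ : v z + η * v z + (distMatrix Γ 4 *ᵥ v) z = 0 := by
      have h := hv.distMatrix_mulVec_apply_add_add hΓ hb hD (i := 0) hz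
      rwa [hΓ.distMatrix_zero, one_mulVec, hη z hz] at h
    rw [hE]
    push_cast
    linear_combination star v z * F 4 * h₄
  · rw [Pi.star_apply, hv.supportedAt z hz, star_zero, zero_mul, zero_mul, mul_zero]

variable (hD : 4 ≤ Γ.diam) (hv0 : v ≠ 0)

include hD hv0

open scoped ComplexOrder in
theorem eigenProj_mulVec_eq_zero_iff {t : ℝ} (ht : t ∈ spec Γ) :
    eigenProj Γ t *ᵥ v = 0 ↔
      (b Γ 0 ^ 2 - t ^ 2) * (b Γ 2 * b Γ 3 + (1 + η) * (t ^ 2 - b Γ 2)) = 0 := by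
  obtain ⟨F, hF0, hF, hrec⟩ := hΓ.exists_eigenProj_apply_eq hb ht
  have hb₀ : b Γ 0 * b Γ 1 * b Γ 2 * b Γ 3 ≠ 0 := by
    have hpos : ∀ i < 4, b Γ i ≠ 0 := fun i hi => (hΓ.b_pos (by omega)).ne'
    simp only [ne_eq, mul_eq_zero, hpos, Nat.reduceLT, Nat.ofNat_pos, or_self, not_false_eq_true]
  rw [DRG.eigenProj_mulVec_eq_zero_iff, hv.star_dotProduct_eigenProj_mulVec_eq hΓ hb hη
    (by omega) hF, mul_eq_zero_iff_right (dotProduct_star_self_eq_zero.not.2 hv0),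
    Complex.ofReal_eq_zero, ← mul_eq_zero_iff_left hb₀,
    hΓ.prod_b_mul_eq_of_recurrence hb hD hrec, mul_eq_zero_iff_left hF0]

end LocalEigenvalue

variable {θ : ℝ} (hθ : θ ^ 2 ≠ b Γ 2)
  (hη : ∀ z, Γ.dist x z = 2 → (distMatrix Γ 2 *ᵥ v) z = tilde Γ θ * v z)
  (hD : 4 ≤ Γ.diam) (hv0 : v ≠ 0)

include hθ hη hD hv0

theorem eigenProj_mulVec_eq_zero_iff_sq_eq {t : ℝ} (ht : t ∈ spec Γ) :
    eigenProj Γ t *ᵥ v = 0 ↔ t ^ 2 = b Γ 0 ^ 2 ∨ t ^ 2 = θ ^ 2 := by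
  have htilde := one_add_tilde_mul hθ
  have hne : 1 + tilde Γ θ ≠ 0 := fun h => by
    rw [h, zero_mul, zero_eq_neg] at htilde
    exact mul_ne_zero (hΓ.b_pos (by omega)).ne' (hΓ.b_pos (by omega)).ne' htilde
  have hfactor : b Γ 2 * b Γ 3 + (1 + tilde Γ θ) * (t ^ 2 - b Γ 2) =
      (1 + tilde Γ θ) * (t ^ 2 - θ ^ 2) := by
    linear_combination htilde
  rw [hv.eigenProj_mulVec_eq_zero_iff hΓ hb hη hD hv0 ht, hfactor, mul_eq_zero,
    mul_eq_zero_iff_left hne, sub_eq_zero, sub_eq_zero, eq_comm]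

end IsEndpointTwoVector

theorem IsEndpointTwoVector.primIdem_mulVec_ne_zero_iff [DecidableEq X] {x : X} {v : X → ℂ}
    (hv : IsEndpointTwoVector Γ x v) (hΓ : IsDistanceRegular Γ) (hb : Γ.IsBipartite) {n : ℕ}
    (hn : n ≤ Γ.diam) (hθ : eigenvalue Γ n ^ 2 ≠ b Γ 2)
    (hη : ∀ z, Γ.dist x z = 2 → (distMatrix Γ 2 *ᵥ v) z = tilde Γ (eigenvalue Γ n) * v z)
    (hD : 4 ≤ Γ.diam) (hv0 : v ≠ 0) {j : ℕ} (hj : j ≤ Γ.diam) :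
    primIdem Γ j *ᵥ v ≠ 0 ↔ j ∈ indexSet Γ.diam n := by
  rw [primIdem_eq_eigenProj, Ne, hv.eigenProj_mulVec_eq_zero_iff_sq_eq hΓ hb hθ hη hD hv0
    (hΓ.eigenvalue_mem_spec hb hj), ← hΓ.eigenvalue_zero hb,
    hΓ.eigenvalue_sq_eq_iff hb hj (Nat.zero_le _), hΓ.eigenvalue_sq_eq_iff hb hj hn,
    Nat.sub_zero, mem_indexSet_iff hj]

theorem IsEndpointTwoVector.span_primIdem_mulVec [DecidableEq X] {x : X} {v : X → ℂ}
    (hv : IsEndpointTwoVector Γ x v) (hΓ : IsDistanceRegular Γ) (hb : Γ.IsBipartite)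
    (hD : 2 ≤ Γ.diam) {W : Submodule ℂ (X → ℂ)} (hthin : IsThin Γ x W) (hvW : v ∈ W)
    (hW : IsIrreducibleTModule Γ x W) (hv0 : v ≠ 0) {J : Finset ℕ} (hJ : ∀ j ∈ J, j ≤ Γ.diam)
    (h₀ : ∀ j ≤ Γ.diam, j ∉ J → primIdem Γ j *ᵥ v = 0) :
    Submodule.span ℂ (Set.range fun j : {j : ℕ // j ∈ J} => primIdem Γ j *ᵥ v) = W := by
  refine le_antisymm (Submodule.span_le.2 (Set.range_subset_iff.2 fun j => ?_))
    (hv.le_of_adj_mulVec_mem hΓ hb hD hthin hvW hW hv0 ?_ ?_)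
  · obtain ⟨q, hq⟩ := exists_aeval_eq_eigenProj (hΓ.eigenvalue_mem_spec hb (hJ j j.2))
    rw [primIdem_eq_eigenProj, ← hq]
    exact aeval_mulVec_mem (fun _ => hW.1.adj_mulVec_mem) q hvW
  · set U := Submodule.span ℂ (Set.range fun j : {j : ℕ // j ∈ J} => primIdem Γ j *ᵥ v)
    suffices U ≤ U.comap (distMatrix Γ 1).mulVecLin from fun w hw => this hw
    refine Submodule.span_le.2 (Set.range_subset_iff.2 fun j => ?_)
    rw [SetLike.mem_coe, Submodule.mem_comap, mulVecLin_apply, mulVec_mulVec,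
      primIdem_eq_eigenProj, adj_mul_eigenProj, smul_mulVec]
    exact U.smul_mem (eigenvalue Γ j : ℂ) (Submodule.subset_span ⟨j, rfl⟩)
  · have hsum := hΓ.aeval_mulVec_eq_sum_primIdem_mulVec hb hJ h₀ 1
    simp only [map_one, one_mulVec, eval_one, one_smul] at hsum
    nth_rw 2 [hsum]
    exact Submodule.sum_mem _ fun j hj => Submodule.subset_span ⟨⟨j, hj⟩, rfl⟩

end PrimitiveIdempotents

section Ratios

-- For `P i = p_i(θ)` and `r` the ratios between `E*_{i+2} A_{i+4} v` and `E*_{i+2} A_i v`, this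
-- expresses `r` through the coefficients of `g_i`. The last identity of the stronger induction
-- hypothesis spares a division by `c_0 = 0`.
theorem ratio_of_recurrence {K : Type*} [Field K] {D : ℕ} {c b P r : ℕ → K} {θ : K}
    (hb : ∀ i < D, b i ≠ 0) (hc₀ : c 0 = 0) (hc₁ : c 1 = 1) (hP₀ : P 0 = 1) (hP₁ : P 1 = θ)
    (hθ : θ ≠ 0) (hP₂ : P 2 ≠ 0)
    (hP : ∀ i, i + 2 ≤ D → θ * P (i + 1) = c (i + 2) * P (i + 2) + b (i + 2) * P i)
    (hr₂ : r 2 * (P 2 * c 2) = b 2 * b 3)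
    (hr : ∀ i, i + 5 ≤ D → r (i + 3) * (r (i + 1) * c i + b (i + 2) - c (i + 2) * r (i + 2)) =
      b (i + 4) * r (i + 2)) {i : ℕ} (hi : i + 4 ≤ D) :
    P i ≠ 0 ∧ P (i + 2) ≠ 0 ∧
      r (i + 2) * (P (i + 2) * c (i + 1) * c (i + 2)) = P i * b (i + 2) * b (i + 3) := by
  suffices h : P i ≠ 0 ∧ P (i + 1) ≠ 0 ∧ P (i + 2) ≠ 0 ∧
      r (i + 2) * (P (i + 2) * c (i + 1) * c (i + 2)) = P i * b (i + 2) * b (i + 3) ∧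
      P (i + 1) * c (i + 1) * (r (i + 1) * c i + b (i + 2)) = b (i + 2) * θ * P i from
    ⟨h.1, h.2.2.1, h.2.2.2.1⟩
  induction i with
  | zero =>
    refine ⟨hP₀ ▸ one_ne_zero, hP₁ ▸ hθ, hP₂, ?_, ?_⟩
    · rw [zero_add, zero_add, zero_add, hc₁, hP₀, mul_one, one_mul, hr₂]
    · rw [zero_add, zero_add, hc₀, hc₁, hP₀, hP₁]
      ring
  | succ i ih =>
    obtain ⟨hPi, hPi₁, hPi₂, hratio, hprev⟩ := ih (by omega)
    have hratio' : r (i + 3) * (P (i + 3) * c (i + 2) * c (i + 3)) =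
        P (i + 1) * b (i + 3) * b (i + 4) := by
      apply mul_left_cancel₀ (mul_ne_zero hPi (hb (i + 2) (by omega)))
      linear_combination (P (i + 1) * c (i + 1) * P (i + 2) * c (i + 2)) * hr i hi -
        r (i + 3) * P (i + 2) * c (i + 2) * hprev +
        (r (i + 3) * c (i + 2) * P (i + 1) + b (i + 4) * P (i + 1)) * hratio -
        r (i + 3) * P i * b (i + 2) * c (i + 2) * hP (i + 1) (by omega)
    refine ⟨hPi₁, hPi₂, fun h₀ => ?_, hratio', ?_⟩
    · rw [h₀, zero_mul, zero_mul, mul_zero] at hratio'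
      exact mul_ne_zero (mul_ne_zero hPi₁ (hb _ (by omega))) (hb _ (by omega)) hratio'.symm
    · linear_combination hratio - b (i + 3) * hP i (by omega)

variable {X : Type*} [Fintype X] {Γ : SimpleGraph X}

namespace IsDistanceRegular

variable (hΓ : IsDistanceRegular Γ)

include hΓ

theorem eval_p_one (hD : 1 ≤ Γ.diam) (θ : ℝ) : (p Γ 1).eval θ = θ := by
  rw [p_one, hΓ.f_one hD, eval_X]

variable (hb : Γ.IsBipartite)

include hb

theorem mul_eval_p (θ : ℝ) {i : ℕ} (hi : i + 2 ≤ Γ.diam) :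
    θ * (p Γ (i + 1)).eval θ =
      c Γ (i + 2) * (p Γ (i + 2)).eval θ + b Γ (i + 2) * (p Γ i).eval θ := by
  simpa only [eval_mul, eval_add, eval_X, eval_C] using congrArg (eval θ) (hΓ.X_mul_p hb hi)

theorem eval_p_two_mul (hD : 2 ≤ Γ.diam) (θ : ℝ) :
    (p Γ 2).eval θ * c Γ 2 = θ ^ 2 - b Γ 2 := by
  have h := hΓ.mul_eval_p hb θ (i := 0) hD
  rw [zero_add, hΓ.eval_p_one (by omega), p_zero, eval_one] at h
  linarith

end IsDistanceRegular

variable [DecidableEq X] {x : X} {v : X → ℂ} {W : Submodule ℂ (X → ℂ)}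

theorem IsTModule.exists_lo_eq_smul_up (hW : IsTModule Γ x W) (hΓ : IsDistanceRegular Γ)
    (hb : Γ.IsBipartite) (hthin : IsThin Γ x W) (hvW : v ∈ W)
    (hup : ∀ i, i + 4 ≤ Γ.diam → up Γ x v i ≠ 0) :
    ∃ r : ℕ → ℂ, ∀ i, i + 4 ≤ Γ.diam → lo Γ x v (i + 2) = r (i + 2) • up Γ x v i := by
  choose! ρ hρ using fun i (hi : i + 4 ≤ Γ.diam) =>
    hthin.exists_eq_smul (m := i + 2) (by omega) (hW.up_mem hΓ hb i hvW)
      (hW.lo_mem hΓ hb (i + 2) hvW) (supportedAt_up v i) (supportedAt_lo v (i + 2)) (hup i hi)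
  exact ⟨fun j => ρ (j - 2), hρ⟩

namespace IsEndpointTwoVector

variable (hv : IsEndpointTwoVector Γ x v) (hΓ : IsDistanceRegular Γ)
  (hb : Γ.IsBipartite)

include hv hΓ hb

theorem lo_two (hD : 2 ≤ Γ.diam) {η : ℝ}
    (hη : ∀ z, Γ.dist x z = 2 → (distMatrix Γ 2 *ᵥ v) z = η * v z) :
    lo Γ x v 2 = (-(1 + η)) • v := by
  ext z
  rw [lo_apply, Pi.smul_apply, Complex.real_smul]
  split_ifs with hz
  · have h := hv.distMatrix_mulVec_apply_add_add hΓ hb hD (i := 0) hz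
    rw [hΓ.distMatrix_zero, one_mulVec, hη z hz] at h
    push_cast
    linear_combination h
  · rw [hv.supportedAt z hz, mul_zero]

variable (hD : 4 ≤ Γ.diam)

include hD

theorem ratio_recurrence {r : ℕ → ℂ}
    (hr : ∀ i, i + 4 ≤ Γ.diam → lo Γ x v (i + 2) = r (i + 2) • up Γ x v i) {i : ℕ}
    (hi : i + 5 ≤ Γ.diam) (hup : up Γ x v i ≠ 0) :
    r (i + 3) * (r (i + 1) * c Γ i + b Γ (i + 2) - c Γ (i + 2) * r (i + 2)) =
      b Γ (i + 4) * r (i + 2) := by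
  have hD₂ : 2 ≤ Γ.diam := by omega
  have hlo : dualIdem Γ x (i + 2) *ᵥ (distMatrix Γ 1 *ᵥ lo Γ x v (i + 1)) =
      (r (i + 1) * c Γ i) • up Γ x v i := by
    rcases i with _ | i
    · rw [zero_add 1, hv.lo_of_lt hΓ hb hD₂ one_lt_two, c_zero, Complex.ofReal_zero, mul_zero,
        zero_smul, mulVec_zero, mulVec_zero]
    · rw [hr i (by omega), mulVec_smul, mulVec_smul,
        hv.dualIdem_mulVec_adj_mulVec_up_above hΓ hb hD₂ (by omega), mul_smul]
      rfl
  have hbelow := hv.dualIdem_mulVec_adj_mulVec_lo_below hΓ hb hD₂ (i := i + 2) (by omega)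
  rw [hr (i + 1) (by omega), mulVec_smul, mulVec_smul,
    hv.dualIdem_mulVec_adj_mulVec_up_below hΓ hb hD₂ (by omega), hlo, hr i (by omega)] at hbelow
  simp only [← Complex.coe_smul, smul_smul, ← add_smul, ← sub_smul] at hbelow
  exact smul_left_injective ℂ hup hbelow

variable (hW : IsTModule Γ x W) (hthin : IsThin Γ x W) (hvW : v ∈ W)
  {θ : ℝ} (hθ₀ : θ ≠ 0) (hθ : θ ^ 2 ≠ b Γ 2)
  (hη : ∀ z, Γ.dist x z = 2 → (distMatrix Γ 2 *ᵥ v) z = tilde Γ θ * v z)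
  (hup : ∀ i, i + 4 ≤ Γ.diam → up Γ x v i ≠ 0)

include hW hthin hvW hθ₀ hθ hη hup

theorem lo_add_two_eq_smul_up {i : ℕ} (hi : i + 4 ≤ Γ.diam) :
    (p Γ i).eval θ ≠ 0 ∧ (p Γ (i + 2)).eval θ ≠ 0 ∧
      lo Γ x v (i + 2) = ((p Γ i).eval θ * b Γ (i + 2) * b Γ (i + 3) /
        ((p Γ (i + 2)).eval θ * c Γ (i + 1) * c Γ (i + 2))) • up Γ x v i := by
  obtain ⟨r, hr⟩ := hW.exists_lo_eq_smul_up hΓ hb hthin hvW hup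
  have hP₂ := hΓ.eval_p_two_mul hb (by omega) θ
  have hr₂ : r 2 * (((p Γ 2).eval θ : ℝ) * c Γ 2) = b Γ 2 * b Γ 3 := by
    have hlo := (hr 0 hD).symm.trans (hv.lo_two hΓ hb (by omega) hη)
    rw [hv.up_zero hΓ] at hlo
    have hr₂ : r 2 = ((-(1 + tilde Γ θ) : ℝ) : ℂ) :=
      smul_left_injective ℂ (hv.up_zero hΓ ▸ hup 0 hD) hlo
    rw [hr₂]
    norm_cast
    rw [hP₂, neg_mul, one_add_tilde_mul hθ, neg_neg]
  obtain ⟨hPi, hPi₂, hratio⟩ := ratio_of_recurrence (D := Γ.diam) (c := fun i => (c Γ i : ℂ))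
    (b := fun i => (b Γ i : ℂ)) (P := fun i => (((p Γ i).eval θ : ℝ) : ℂ)) (θ := (θ : ℂ))
    (fun j hj => Complex.ofReal_ne_zero.2 (hΓ.b_pos hj).ne') (by rw [c_zero, Complex.ofReal_zero])
    (by rw [hΓ.c_one (by omega), Complex.ofReal_one])
    (by rw [p_zero, eval_one, Complex.ofReal_one]) (by rw [hΓ.eval_p_one (by omega)])
    (Complex.ofReal_ne_zero.2 hθ₀)
    (Complex.ofReal_ne_zero.2 (left_ne_zero_of_mul (hP₂ ▸ sub_ne_zero.2 hθ)))
    (fun j hj => by exact_mod_cast hΓ.mul_eval_p hb θ hj) hr₂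
    (fun j hj => hv.ratio_recurrence hΓ hb hD hr hj (hup j (by omega))) hi
  rw [Complex.ofReal_ne_zero] at hPi hPi₂
  refine ⟨hPi, hPi₂, ?_⟩
  have hden : (p Γ (i + 2)).eval θ * c Γ (i + 1) * c Γ (i + 2) ≠ 0 :=
    mul_ne_zero (mul_ne_zero hPi₂ (hΓ.c_pos (by omega) (by omega)).ne')
      (hΓ.c_pos (by omega) (by omega)).ne'
  rw [hr i hi, ← Complex.coe_smul, Complex.ofReal_div]
  congr 1
  rw [eq_div_iff (Complex.ofReal_ne_zero.2 hden)]
  exact_mod_cast hratio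

theorem aeval_g_mulVec {i : ℕ} (hi : i + 4 ≤ Γ.diam) :
    aeval (distMatrix Γ 1) (g Γ θ i) *ᵥ v = up Γ x v i := by
  induction i using Nat.twoStepInduction with
  | zero => rw [hΓ.g_zero (by omega), map_one, one_mulVec, hv.up_zero hΓ]
  | one => rw [hΓ.g_one (by omega) hθ₀, aeval_X, hv.up_one hΓ hb]
  | more i ih _ =>
    obtain ⟨hPi, hPi₂, hlo⟩ :=
      hv.lo_add_two_eq_smul_up hΓ hb hD hW hthin hvW hθ₀ hθ hη hup (i := i) (by omega)
    rw [hΓ.g_add_two (by omega) hPi hPi₂, map_add, map_mul, aeval_C, ← Algebra.smul_def, add_mulVec,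
      smul_mulVec, ih (by omega), ← hlo, hv.aeval_p_mulVec hΓ hb (by omega) (by omega),
      sub_add_cancel]

end IsEndpointTwoVector

end Ratios

section Dimension

variable {X : Type*} [Fintype X] {Γ : SimpleGraph X}

theorem le_of_mem_indexSet {D n j : ℕ} (hj : j ∈ indexSet D n) : j ≤ D := by
  have := mem_Icc.1 (mem_filter.1 hj).1
  omega

theorem IsDistanceRegular.eigenvalue_sq_ne_b_two [DecidableEq X] (hΓ : IsDistanceRegular Γ)
    (hb : Γ.IsBipartite) (hD : 4 ≤ Γ.diam) {n : ℕ} (hn : n = 1 ∨ n = Γ.diam / 2) :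
    eigenvalue Γ n ^ 2 ≠ b Γ 2 := by
  rcases hn with rfl | rfl
  · exact (hΓ.b_two_lt_eigenvalue_one_sq hb hD).ne'
  · exact (hΓ.eigenvalue_half_diam_sq_lt_b_two hb hD).ne

theorem IsEndpointTwoVector.finrank_eq_card [DecidableEq X] {x : X} {v : X → ℂ}
    (hv : IsEndpointTwoVector Γ x v) (hΓ : IsDistanceRegular Γ) (hb : Γ.IsBipartite)
    (hD : 2 ≤ Γ.diam) {W : Submodule ℂ (X → ℂ)} (hthin : IsThin Γ x W) (hvW : v ∈ W)
    (hW : IsIrreducibleTModule Γ x W) (hv0 : v ≠ 0) {J : Finset ℕ} (hJ : ∀ j ∈ J, j ≤ Γ.diam)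
    (hE : ∀ j ≤ Γ.diam, primIdem Γ j *ᵥ v ≠ 0 ↔ j ∈ J) : Module.finrank ℂ W = #J := by
  have hli := hΓ.linearIndependent_primIdem_mulVec hb hJ fun j hj => (hE j (hJ j hj)).2 hj
  rw [← hv.span_primIdem_mulVec hΓ hb hD hthin hvW hW hv0 hJ fun j hj => not_imp_comm.1 (hE j hj).1,
    finrank_span_eq_card hli, Fintype.card_coe]

end Dimension

end DRG

theorem mainTheorem10 {X : Type*} [Fintype X] [DecidableEq X] (Γ : SimpleGraph X)
    (hΓ : DRG.IsDistanceRegular Γ) (hbip : Γ.IsBipartite)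
    (D : ℕ) (hdiam : Γ.diam = D) (hD : 4 ≤ D) (hk : 3 ≤ DRG.b Γ 0) (x : X)
    (n : ℕ) (hn : n = 1 ∨ (Odd D ∧ n = D / 2))
    (W : Submodule ℂ (X → ℂ)) (hW : DRG.IsIrreducibleTModule Γ x W)
    (hthin : DRG.IsThin Γ x W) (hend : DRG.endpoint Γ x W = 2)
    (hloc : DRG.HasLocalEigenvalue Γ x W (DRG.tilde Γ (DRG.eigenvalue Γ n)))
    (v : X → ℂ) (hv : v ∈ DRG.dualPart Γ x 2 W) (hv0 : v ≠ 0) :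
    -- the vectors `E_j v` (`1 ≤ j ≤ D - 1`, `j ≠ n`, `j ≠ D - n`) form a basis of `W`
    (LinearIndependent ℂ
        (fun j : {j : ℕ // j ∈ DRG.indexSet D n} => (DRG.primIdem Γ j).mulVec v) ∧
      Submodule.span ℂ (Set.range
        (fun j : {j : ℕ // j ∈ DRG.indexSet D n} => (DRG.primIdem Γ j).mulVec v)) = W) ∧
    -- the vectors `E*_{i+2} A_i v` (`0 ≤ i ≤ D - 4`) form a basis of `W`
    (LinearIndependent ℂ
        (fun i : {i : ℕ // i + 4 ≤ D} =>
          (DRG.dualIdem Γ x (i + 2) * DRG.distMatrix Γ i).mulVec v) ∧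
      Submodule.span ℂ (Set.range
        (fun i : {i : ℕ // i + 4 ≤ D} =>
          (DRG.dualIdem Γ x (i + 2) * DRG.distMatrix Γ i).mulVec v)) = W) ∧
    -- the transition matrix between them
    (∀ i : ℕ, i + 4 ≤ D →
      (DRG.dualIdem Γ x (i + 2) * DRG.distMatrix Γ i).mulVec v =
        ∑ j ∈ DRG.indexSet D n,
          (((DRG.g Γ (DRG.eigenvalue Γ n) i).eval (DRG.eigenvalue Γ j) : ℝ) : ℂ) •
            (DRG.primIdem Γ j).mulVec v) := by
  subst hdiam
  have hnD : 1 ≤ n ∧ 2 * n < Γ.diam := by rcases hn with rfl | ⟨⟨m, hm⟩, rfl⟩ <;> omega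
  have hθ₀ := (hΓ.eigenvalue_pos hbip hnD.2).ne'
  have hθ := hΓ.eigenvalue_sq_ne_b_two hbip hD (hn.imp_right And.right)
  have hη := fun z => hloc.distMatrix_two_mulVec_apply hv (z := z)
  have hvW := hW.1.mem_of_mem_dualPart hv
  replace hv := hW.1.isEndpointTwoVector hΓ.1 hend hv
  have hD₂ : 2 ≤ Γ.diam := by omega
  have hJ : ∀ j ∈ DRG.indexSet Γ.diam n, j ≤ Γ.diam := fun j => DRG.le_of_mem_indexSet
  have hE := fun j => hv.primIdem_mulVec_ne_zero_iff hΓ hbip (by omega) hθ hη hD hv0 (j := j)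
  have hE₀ := fun j hj => not_imp_comm.1 (hE j hj).1
  have hup : ∀ i, DRG.up Γ x v i ≠ 0 ↔ i + 4 ≤ Γ.diam := fun i => by
    rw [hv.up_ne_zero_iff hΓ hbip hD₂ hthin hvW hW hv0,
      hv.finrank_eq_card hΓ hbip hD₂ hthin hvW hW hv0 hJ hE, DRG.card_indexSet hnD.1 hnD.2]
    omega
  exact ⟨⟨hΓ.linearIndependent_primIdem_mulVec hbip hJ fun j hj => (hE j (hJ j hj)).2 hj,
      hv.span_primIdem_mulVec hΓ hbip hD₂ hthin hvW hW hv0 hJ hE₀⟩,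
    ⟨DRG.linearIndependent_up fun i => (hup i).2,
      hv.span_up hΓ hbip hD₂ hthin hvW hW hv0 fun i => not_imp_comm.1 (hup i).1⟩,
    fun i hi => (hv.aeval_g_mulVec hΓ hbip hD hW.1 hthin hvW hθ₀ hθ hη (fun j => (hup j).2)
      hi).symm.trans (hΓ.aeval_mulVec_eq_sum_primIdem_mulVec hbip hJ hE₀ _)⟩
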